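/- Let $\tau$ be a complex number with $\operatorname{Im}\tau>0$, put $q=e^{2\pi i\tau}$ and $q^{r}=e^{2\pi i\tau r}$ for real $r$, and let $\eta(\tau)=q^{1/24}\prod_{n\ge1}(1-q^n)$. Write $$j(x;q)=\sum_{n\in\mathbb Z}(-1)^nq^{n(n-1)/2}x^n,\qquad J_{a,m}=j(q^a;q^m),$$ $$f_{a,b,c}(x,y,q)=\Big(\sum_{r,s\ge0}-\sum_{r,s<0}\Big)(-1)^{r+s}x^ry^sq^{a\frac{r(r-1)}2+brs+c\frac{s(s-1)}2}.$$ For integers $m,\ell,N$ with $0\le\ell\le N$, $N\ge1$ and $m\equiv\ell\pmod 2$, let $c_{N-m,m}^{N-\ell,\ell}$ denote the level-$N$ string function of the affine Lie algebra $A_1^{(1)}$, given by the Kac–Peterson series $$c_{N-m,m}^{N-\ell,\ell}(\tau)=\frac1{\eta(\tau)^3}\sum_{(x,y)}\operatorname{sg}(x)\,q^{(N+2)x^2-Ny^2},$$ where $\operatorname{sg}(x)=1$ for $x\ge0$ and $-1$ for $x<0$, and the sum is over all $(x,y)\in\mathbb R^2$ with $-|x|<y\le|x|$ such that $(x,y)$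 or $(\tfrac12-x,\tfrac12+y)$ lies in $\big(\tfrac{\ell+1}{2(N+2)},\tfrac m{2N}\big)+\mathbb Z^2$. Then: 1. The double series $f_{6,6,1}(q^6,q^4,q)$ converges absolutely, and $$f_{6,6,1}(q^6,q^4,q)=J_{4,10}\,J_{3,15}.$$ 2. For $N=10$, $\ell=5$, $m=1$ the Kac–Peterson series converges absolutely, and $$c_{91}^{55}(\tau)=\eta(\tau)^{-3}q^{29/40}f_{6,6,1}(q^6,q^4,q),$$ so that the identity in 1 is equivalent to the evaluation in 3. 3. The level-10 string function has the Kac–Peterson evaluation $$c_{91}^{55}(\tau)=\eta(\tau)^{-3}q^{29/40}\prod_{\substack{n\ge1\\ n\not\equiv\pm1\ (\mathrm{mod}\ 5)}}(1-q^{2n})\prod_{\substack{n\ge1\\ n\not\equiv\pm2\ (\mathrm{mod}\ 5)}}(1-q^{3n}).$$ -/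

import Mathlib

noncomputable section

namespace HeckeString

/-- The power `q ^ r = exp (2 π i τ r)` of the nome `q = exp (2 π i τ)`, for a real exponent `r`. -/
def qPow (τ : UpperHalfPlane) (r : ℝ) : ℂ :=
  Complex.exp (2 * Real.pi * Complex.I * (τ : ℂ) * (r : ℂ))

/-- The theta function `j(x; q) = ∑_{n ∈ ℤ} (-1)^n q^{n(n-1)/2} x^n`. -/
def theta (x q : ℂ) : ℂ :=
  ∑' n : ℤ, (-1 : ℂ) ^ n * q ^ (n * (n - 1) / 2) * x ^ n

/-- `J_{a,m} = j(q^a; q^m)`. -/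
def thetaJ (a : ℤ) (m : ℕ) (q : ℂ) : ℂ :=
  theta (q ^ a) (q ^ m)

/-- The summand `(-1)^{r+s} x^r y^s q^{a r(r-1)/2 + b r s + c s(s-1)/2}`. -/
def heckeTerm (a b c : ℤ) (x y q : ℂ) (p : ℤ × ℤ) : ℂ :=
  (-1 : ℂ) ^ (p.1 + p.2) * x ^ p.1 * y ^ p.2 *
    q ^ (a * (p.1 * (p.1 - 1) / 2) + b * p.1 * p.2 + c * (p.2 * (p.2 - 1) / 2))

/-- The index pairs `(r, s)` with `r, s ≥ 0`. -/
def nonnegPairs : Set (ℤ × ℤ) := {p | 0 ≤ p.1 ∧ 0 ≤ p.2}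

/-- The index pairs `(r, s)` with `r, s < 0`. -/
def negPairs : Set (ℤ × ℤ) := {p | p.1 < 0 ∧ p.2 < 0}

/-- The Hecke-type double-sum `f_{a,b,c}(x, y, q)`. -/
def heckeSum (a b c : ℤ) (x y q : ℂ) : ℂ :=
  (∑' p : nonnegPairs, heckeTerm a b c x y q p) - ∑' p : negPairs, heckeTerm a b c x y q p

/-- Absolute convergence of the double series that defines `f_{a,b,c}(x, y, q)`. -/
def HeckeSummable (a b c : ℤ) (x y q : ℂ) : Prop :=
  (Summable fun p : nonnegPairs => heckeTerm a b c x y q p) ∧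
    Summable fun p : negPairs => heckeTerm a b c x y q p

/-- `(u, v) ∈ ((ℓ + 1) / (2 (N + 2)), m / (2 N)) + ℤ²`. -/
def InCoset (m l N : ℤ) (u v : ℝ) : Prop :=
  ∃ i k : ℤ, u = ((l : ℝ) + 1) / (2 * ((N : ℝ) + 2)) + i ∧ v = (m : ℝ) / (2 * (N : ℝ)) + k

/-- The index set of the Kac-Peterson double series: the `(x, y)` with `-|x| < y ≤ |x|` such that
`(x, y)` or `(1/2 - x, 1/2 + y)` lies in the coset above. -/
def kpIndex (m l N : ℤ) : Set (ℝ × ℝ) :=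
  {p | (-|p.1| < p.2 ∧ p.2 ≤ |p.1|) ∧
    (InCoset m l N p.1 p.2 ∨ InCoset m l N (1 / 2 - p.1) (1 / 2 + p.2))}

/-- The summand `sg(x) q^{(N + 2) x² - N y²}`, with `sg(x) = 1` for `x ≥ 0` and `-1` for `x < 0`. -/
def kpTerm (N : ℤ) (τ : UpperHalfPlane) (p : ℝ × ℝ) : ℂ :=
  (if 0 ≤ p.1 then 1 else -1) *
    qPow τ (((N : ℝ) + 2) * p.1 ^ 2 - (N : ℝ) * p.2 ^ 2)

/-- The level `N` string function `c_{N-m,m}^{N-ℓ,ℓ}(τ)` of type `A₁⁽¹⁾` in its Kac-Peterson form: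
`η(τ)⁻³` times an indefinite theta series. -/
def stringFunction (m l N : ℤ) (τ : UpperHalfPlane) : ℂ :=
  ModularForm.eta (τ : ℂ) ^ (-3 : ℤ) * ∑' p : kpIndex m l N, kpTerm N τ p

end HeckeString

end

/-!
Expanding `(q⁶; q⁶)³ / θ(q⁴ / z; q⁶)` as a Laurent series exhibits `f_{6,6,1}(q⁶, q⁴, q)` as the
constant term in `z` of `(q⁶; q⁶)³ θ(z; q) / θ(q⁴ / z; q⁶)`. By the triple product, `θ(z; q)` is a
constant multiple of `θ(q z; q²) θ(z; q⁶) θ(q⁴ z; q⁶) θ(q⁴ / z; q⁶)`, so the quotient is a product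
of three theta functions, whose constant term is a positive-definite binary theta series.
Multiplied by `(q², q⁸; q¹⁰)`, that series equals `θ(-q³; q⁴) J_{3,15}`: splitting both lattices
into cosets gives sums of products of theta functions that agree by the triple product.

The string function reduces to the double sum because the pairs `(r, s)` with `r, s ≥ 0` or
`r, s < 0` parametrize the Kac–Peterson index set.
-/

open Filter Topology Finset

namespace HeckeString

/-- The `q`-Pochhammer symbol `(x; q)_∞ = ∏_{n ≥ 0} (1 - x q ^ n)`. -/
noncomputable def qPoch (x q : ℂ) : ℂ := ∏' n : ℕ, (1 - x * q ^ n)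

section qPoch

variable {x q : ℂ}

lemma norm_pow_lt_one (hq : ‖q‖ < 1) {n : ℕ} (hn : n ≠ 0) : ‖q ^ n‖ < 1 := by
  rw [norm_pow]; exact pow_lt_one₀ (norm_nonneg _) hq hn

lemma one_sub_mul_pow_ne_zero (hx : ‖x‖ < 1) (hq : ‖q‖ < 1) (n : ℕ) : 1 - x * q ^ n ≠ 0 := by
  refine sub_ne_zero.2 fun h => ?_
  have hlt : ‖x * q ^ n‖ < 1 := by
    rw [norm_mul, norm_pow]
    exact mul_lt_one_of_nonneg_of_lt_one_left (norm_nonneg _) hx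
      (pow_le_one₀ (norm_nonneg _) hq.le)
  rw [← h, norm_one] at hlt
  exact lt_irrefl _ hlt

lemma summable_norm_neg_mul_pow (x : ℂ) (hq : ‖q‖ < 1) :
    Summable fun n : ℕ => ‖-(x * q ^ n)‖ := by
  simpa using (summable_geometric_of_lt_one (norm_nonneg _) hq).mul_left ‖x‖

lemma multipliable_qPoch (x : ℂ) (hq : ‖q‖ < 1) : Multipliable fun n : ℕ => 1 - x * q ^ n := by
  simpa only [sub_eq_add_neg] using
    multipliable_one_add_of_summable (summable_norm_neg_mul_pow x hq)

lemma tendsto_qPoch (x : ℂ) (hq : ‖q‖ < 1) :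
    Tendsto (fun n => ∏ k ∈ range n, (1 - x * q ^ k)) atTop (𝓝 (qPoch x q)) :=
  (multipliable_qPoch x hq).hasProd.tendsto_prod_nat

lemma qPoch_ne_zero (hx : ‖x‖ < 1) (hq : ‖q‖ < 1) : qPoch x q ≠ 0 := by
  have h := tprod_one_add_ne_zero_of_summable (f := fun n : ℕ => -(x * q ^ n))
    (fun n => by simpa only [sub_eq_add_neg] using one_sub_mul_pow_ne_zero hx hq n)
    (summable_norm_neg_mul_pow x hq)
  simpa only [qPoch, sub_eq_add_neg] using h

lemma continuous_qPoch (hq : ‖q‖ < 1) : Continuous fun x => qPoch x q := by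
  simp only [qPoch, sub_eq_add_neg]
  refine continuous_iff_continuousAt.2 fun x => tendsto_tprod_one_add_of_dominated_convergence
    (bound := fun n => (‖x‖ + 1) * ‖q‖ ^ n)
    ((summable_geometric_of_lt_one (norm_nonneg _) hq).mul_left _)
    (fun n => Continuous.tendsto (by fun_prop) x) ?_
  filter_upwards [(continuous_norm.tendsto x).eventually_le_const (lt_add_one ‖x‖)] with y hy n
  rw [norm_neg, norm_mul, norm_pow]
  gcongr

lemma qPoch_eq_one_sub_mul (x : ℂ) (hq : ‖q‖ < 1) : qPoch x q = (1 - x) * qPoch (x * q) q := by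
  have hshift (n : ℕ) : 1 - x * q ^ (n + 1) = 1 - x * q * q ^ n := by ring
  rw [qPoch, tprod_eq_zero_mul' (by simpa only [hshift] using multipliable_qPoch (x * q) hq)]
  simp only [hshift, pow_zero, mul_one, qPoch]

lemma qPoch_mul_qPoch_neg (x : ℂ) (hq : ‖q‖ < 1) :
    qPoch x q * qPoch (-x) q = qPoch (x ^ 2) (q ^ 2) := by
  rw [qPoch, qPoch, ← (multipliable_qPoch x hq).tprod_mul (multipliable_qPoch (-x) hq)]
  exact tprod_congr fun n => by ring

lemma prod_range_mul {M : Type*} [CommMonoid M] (f : ℕ → M) (m n : ℕ) :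
    ∏ i ∈ range (m * n), f i = ∏ k ∈ range m, ∏ i ∈ range n, f (m * i + k) := by
  induction n with
  | zero => simp
  | succ n ih =>
    simp only [Nat.mul_succ, prod_range_add, ih, prod_range_succ, prod_mul_distrib]

lemma qPoch_eq_prod_range (x : ℂ) (hq : ‖q‖ < 1) {m : ℕ} (hm : m ≠ 0) :
    qPoch x q = ∏ k ∈ range m, qPoch (x * q ^ k) (q ^ m) := by
  refine tendsto_nhds_unique
    ((tendsto_qPoch x hq).comp (tendsto_id.const_mul_atTop' (Nat.pos_of_ne_zero hm))) ?_
  simp only [Function.comp_def, id_eq, prod_range_mul]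
  refine tendsto_finsetProd _ fun k _ => ?_
  refine (tendsto_qPoch (x * q ^ k) (norm_pow_lt_one hq hm)).congr fun n => ?_
  exact prod_congr rfl fun i _ => by ring

end qPoch

lemma two_mul_triangle (n : ℤ) : 2 * (n * (n - 1) / 2) = n * (n - 1) :=
  Int.mul_ediv_cancel' (Int.even_mul_pred_self n).two_dvd

lemma triangle_add_one (n : ℤ) : (n + 1) * (n + 1 - 1) / 2 = n * (n - 1) / 2 + n := by
  have := two_mul_triangle n
  have := two_mul_triangle (n + 1)
  linarith

lemma triangle_neg (n : ℤ) : -n * (-n - 1) / 2 = n * (n - 1) / 2 + n := by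
  have := two_mul_triangle n
  have := two_mul_triangle (-n)
  linarith

/-- The `n`-th term `(-1)^n q^{n(n-1)/2} x^n` of the series `θ(x; q)`. -/
noncomputable def thetaTerm (x q : ℂ) (n : ℤ) : ℂ :=
  (-1 : ℂ) ^ n * q ^ (n * (n - 1) / 2) * x ^ n

section theta

variable {x q : ℂ}

lemma thetaTerm_mul (x z q : ℂ) (n : ℤ) : thetaTerm (x * z) q n = thetaTerm x q n * z ^ n := by
  simp [thetaTerm, mul_zpow, mul_assoc]

lemma thetaTerm_ne_zero (hx : x ≠ 0) (hq : q ≠ 0) (n : ℤ) : thetaTerm x q n ≠ 0 :=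
  mul_ne_zero (mul_ne_zero (zpow_ne_zero _ (by norm_num)) (zpow_ne_zero _ hq)) (zpow_ne_zero _ hx)

lemma thetaTerm_add_one (hx : x ≠ 0) (hq : q ≠ 0) (n : ℤ) :
    thetaTerm x q (n + 1) = -x * q ^ n * thetaTerm x q n := by
  rw [thetaTerm, triangle_add_one, zpow_add₀ hq, zpow_add_one₀ hx, zpow_add_one₀ (by norm_num),
    thetaTerm]
  ring

lemma thetaTerm_neg (hq : q ≠ 0) (n : ℤ) : thetaTerm x q (-n) = thetaTerm (q / x) q n := by
  rw [thetaTerm, triangle_neg, zpow_add₀ hq, zpow_neg, zpow_neg, ← inv_zpow (-1 : ℂ), inv_neg_one,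
    thetaTerm, div_zpow]
  ring

lemma summable_norm_thetaTerm_nat (hx : x ≠ 0) (hq0 : q ≠ 0) (hq : ‖q‖ < 1) :
    Summable fun n : ℕ => ‖thetaTerm x q n‖ := by
  have hne (n : ℕ) : ‖thetaTerm x q n‖ ≠ 0 := norm_ne_zero_iff.2 (thetaTerm_ne_zero hx hq0 n)
  refine summable_of_ratio_test_tendsto_lt_one (l := 0) zero_lt_one (.of_forall hne) ?_
  have hlim : Tendsto (fun n : ℕ => ‖x‖ * ‖q‖ ^ n) atTop (𝓝 0) := by
    simpa using (tendsto_pow_atTop_nhds_zero_of_lt_one (norm_nonneg q) hq).const_mul ‖x‖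
  refine hlim.congr fun n => ?_
  rw [norm_norm, norm_norm, Nat.cast_succ, thetaTerm_add_one hx hq0, norm_mul,
    mul_div_cancel_right₀ _ (hne n), norm_mul, norm_neg, norm_zpow, zpow_natCast]

lemma summable_norm_thetaTerm (hx : x ≠ 0) (hq0 : q ≠ 0) (hq : ‖q‖ < 1) :
    Summable fun n : ℤ => ‖thetaTerm x q n‖ := by
  refine (summable_norm_thetaTerm_nat hx hq0 hq).of_nat_of_neg ?_
  simpa only [thetaTerm_neg hq0] using summable_norm_thetaTerm_nat (div_ne_zero hq0 hx) hq0 hq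

lemma hasSum_theta (hx : x ≠ 0) (hq0 : q ≠ 0) (hq : ‖q‖ < 1) :
    HasSum (thetaTerm x q) (theta x q) :=
  (summable_norm_thetaTerm hx hq0 hq).of_norm.hasSum

lemma theta_zpow_eq_zero (hq0 : q ≠ 0) (hq : ‖q‖ < 1) (k : ℤ) : theta (q ^ k) q = 0 := by
  have hsum := hasSum_theta (zpow_ne_zero k hq0) hq0 hq
  have hodd (n : ℤ) : thetaTerm (q ^ k) q (1 - 2 * k - n) = -thetaTerm (q ^ k) q n := by
    have hsign : (-1 : ℂ) ^ (1 - 2 * k - n) = -(-1 : ℂ) ^ n := by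
      rw [zpow_sub₀ (by norm_num), zpow_sub₀ (by norm_num), zpow_mul, even_two.neg_zpow,
        one_zpow, one_zpow, zpow_one, div_one, div_eq_mul_inv, ← inv_zpow, inv_neg_one, neg_one_mul]
    have hexp : (1 - 2 * k - n) * (1 - 2 * k - n - 1) / 2 + k * (1 - 2 * k - n) =
        n * (n - 1) / 2 + k * n := by
      have := two_mul_triangle (1 - 2 * k - n)
      have := two_mul_triangle n
      linarith
    simp only [thetaTerm, ← zpow_mul, mul_assoc, ← zpow_add₀ hq0]
    rw [hsign, hexp, neg_mul]
  have hneg := (Equiv.subLeft (1 - 2 * k)).hasSum_iff.2 hsum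
  simp only [Function.comp_def, Equiv.subLeft_apply, hodd] at hneg
  exact self_eq_neg.1 (hneg.unique hsum.neg)

end theta

section TripleProduct

/-- The reciprocal of `(q; q)_m`, extended by zero to negative `m`, so that
`invPoch q (m - 1) = (1 - q ^ m) * invPoch q m` holds for every integer `m`. -/
noncomputable def invPoch (q : ℂ) (m : ℤ) : ℂ :=
  if m < 0 then 0 else (∏ k ∈ range m.toNat, (1 - q * q ^ k))⁻¹

/-- The Gaussian binomial coefficient `[2n choose n + j]_q`, which vanishes for `|j| > n`. -/
noncomputable def qCentralBinom (q : ℂ) (n : ℕ) (j : ℤ) : ℂ :=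
  (∏ k ∈ range (2 * n), (1 - q * q ^ k)) * (invPoch q (n - j) * invPoch q (n + j))

variable {x q : ℂ}

lemma invPoch_sub_one (hq : ‖q‖ < 1) (m : ℤ) : invPoch q (m - 1) = (1 - q ^ m) * invPoch q m := by
  rcases lt_trichotomy m 0 with hm | rfl | hm
  · simp [invPoch, hm, hm.trans zero_lt_one]
  · simp [invPoch]
  · obtain ⟨k, rfl⟩ : ∃ k : ℕ, m = (k + 1 : ℕ) := ⟨(m - 1).toNat, by omega⟩
    have hne := one_sub_mul_pow_ne_zero hq hq k
    rw [invPoch, invPoch, if_neg (by omega), if_neg (by omega), Int.toNat_natCast,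
      show ((k + 1 : ℕ) - 1 : ℤ).toNat = k by omega, prod_range_succ, zpow_natCast, pow_succ']
    field_simp

lemma qCentralBinom_succ (hq0 : q ≠ 0) (hq : ‖q‖ < 1) (n : ℕ) (j : ℤ) :
    qCentralBinom q (n + 1) j = (1 + q ^ (2 * n + 1)) * qCentralBinom q n j +
      q ^ ((n : ℤ) - j + 1) * qCentralBinom q n (j - 1) +
      q ^ ((n : ℤ) + j + 1) * qCentralBinom q n (j + 1) := by
  have hX : q ^ ((n : ℤ) - j + 1) = q * q ^ ((n : ℤ) - j) := by rw [zpow_add_one₀ hq0, mul_comm]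
  have hY : q ^ ((n : ℤ) + j + 1) = q * q ^ ((n : ℤ) + j) := by rw [zpow_add_one₀ hq0, mul_comm]
  have hXY : q ^ (2 * n) = q ^ ((n : ℤ) - j) * q ^ ((n : ℤ) + j) := by
    rw [← zpow_add₀ hq0, ← zpow_natCast]; congr 1; push_cast; ring
  have hA := invPoch_sub_one hq ((n : ℤ) - j)
  have hA' := invPoch_sub_one hq ((n : ℤ) - j + 1)
  have hB := invPoch_sub_one hq ((n : ℤ) + j)
  have hB' := invPoch_sub_one hq ((n : ℤ) + j + 1)
  rw [add_sub_cancel_right, hX] at hA'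
  rw [add_sub_cancel_right, hY] at hB'
  simp only [qCentralBinom, Nat.mul_succ, prod_range_succ, Nat.cast_succ]
  rw [show (n : ℤ) + 1 - j = n - j + 1 by ring, show (n : ℤ) + 1 + j = n + j + 1 by ring,
    show (n : ℤ) - (j - 1) = n - j + 1 by ring, show (n : ℤ) + (j - 1) = n + j - 1 by ring,
    show (n : ℤ) - (j + 1) = n - j - 1 by ring, show (n : ℤ) + (j + 1) = n + j + 1 by ring,
    hA, hB, hA', hB', hX, hY, pow_succ q (2 * n), hXY]
  ring

lemma hasSum_qCentralBinom_mul_thetaTerm (hx : x ≠ 0) (hq0 : q ≠ 0) (hq : ‖q‖ < 1) (n : ℕ) :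
    HasSum (fun j : ℤ => qCentralBinom q n j * thetaTerm x q j)
      ((∏ k ∈ range n, (1 - x * q ^ k)) * ∏ k ∈ range n, (1 - q / x * q ^ k)) := by
  induction n with
  | zero =>
    convert hasSum_single (0 : ℤ) fun j hj => ?_ using 1
    · simp [qCentralBinom, invPoch, thetaTerm]
    · rcases lt_or_gt_of_ne hj with h | h <;> simp [qCentralBinom, invPoch, h]
  | succ n ih =>
    have hdown := ((Equiv.subRight (1 : ℤ)).hasSum_iff.2 ih).mul_left (-(x * q ^ n))
    have hup := ((Equiv.addRight (1 : ℤ)).hasSum_iff.2 ih).mul_left (-(q / x * q ^ n))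
    have hprod : (∏ k ∈ range (n + 1), (1 - x * q ^ k)) * ∏ k ∈ range (n + 1), (1 - q / x * q ^ k) =
        (1 + q ^ (2 * n + 1) + -(x * q ^ n) + -(q / x * q ^ n)) *
          ((∏ k ∈ range n, (1 - x * q ^ k)) * ∏ k ∈ range n, (1 - q / x * q ^ k)) := by
      rw [prod_range_succ, prod_range_succ, pow_succ q, pow_mul']
      field_simp
      ring
    rw [hprod, add_mul, add_mul]
    refine (((ih.mul_left (1 + q ^ (2 * n + 1))).add hdown).add hup).congr_fun fun j => ?_
    have hpred : -(x * q ^ n) * thetaTerm x q (j - 1) =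
        q ^ ((n : ℤ) - j + 1) * thetaTerm x q j := by
      rw [show thetaTerm x q j = -x * q ^ (j - 1) * thetaTerm x q (j - 1) by
        rw [← thetaTerm_add_one hx hq0, sub_add_cancel], ← zpow_natCast,
        show q ^ (n : ℤ) = q ^ ((n : ℤ) - j + 1) * q ^ (j - 1) by
          rw [← zpow_add₀ hq0]; congr 1; ring]
      ring
    have hsucc : -(q / x * q ^ n) * thetaTerm x q (j + 1) =
        q ^ ((n : ℤ) + j + 1) * thetaTerm x q j := by
      rw [thetaTerm_add_one hx hq0, zpow_add_one₀ hq0, zpow_add₀ hq0, zpow_natCast]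
      field_simp
    simp only [Function.comp_apply, Equiv.subRight_apply, Equiv.coe_addRight]
    rw [qCentralBinom_succ hq0 hq]
    linear_combination -qCentralBinom q n (j - 1) * hpred - qCentralBinom q n (j + 1) * hsucc

lemma tendsto_invPoch (hq : ‖q‖ < 1) : Tendsto (invPoch q) atTop (𝓝 (qPoch q q)⁻¹) := by
  have hlim := (tendsto_qPoch q hq).inv₀ (qPoch_ne_zero hq hq)
  have htoNat : Tendsto Int.toNat atTop atTop :=
    tendsto_atTop.2 fun b => (eventually_ge_atTop (b : ℤ)).mono fun m hm => by omega
  refine (hlim.comp htoNat).congr' ?_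
  filter_upwards [eventually_ge_atTop 0] with m hm
  simp [invPoch, not_lt.2 hm]

lemma exists_norm_invPoch_le (hq : ‖q‖ < 1) : ∃ C, ∀ m, ‖invPoch q m‖ ≤ C := by
  obtain ⟨C, hC⟩ := ((tendsto_qPoch q hq).inv₀ (qPoch_ne_zero hq hq)).norm.bddAbove_range
  have hC' (n : ℕ) : ‖(∏ k ∈ range n, (1 - q * q ^ k))⁻¹‖ ≤ C := hC ⟨n, rfl⟩
  refine ⟨C, fun m => ?_⟩
  rw [invPoch]
  split_ifs
  · rw [norm_zero]; exact (norm_nonneg _).trans (hC' 0)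
  · exact hC' m.toNat

lemma tendsto_qCentralBinom (hq : ‖q‖ < 1) (j : ℤ) :
    Tendsto (fun n => qCentralBinom q n j) atTop (𝓝 (qPoch q q)⁻¹) := by
  have hmul := ((tendsto_qPoch q hq).comp (tendsto_id.const_mul_atTop' two_pos)).mul
    (((tendsto_invPoch hq).comp
        (tendsto_atTop_add_const_right _ (-j) tendsto_natCast_atTop_atTop)).mul
      ((tendsto_invPoch hq).comp (tendsto_atTop_add_const_right _ j tendsto_natCast_atTop_atTop)))
  rwa [mul_inv_cancel_left₀ (qPoch_ne_zero hq hq)] at hmul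

lemma exists_norm_qCentralBinom_le (hq : ‖q‖ < 1) : ∃ C, ∀ n j, ‖qCentralBinom q n j‖ ≤ C := by
  obtain ⟨C, hC⟩ := exists_norm_invPoch_le hq
  obtain ⟨D, hD⟩ := (tendsto_qPoch q hq).norm.bddAbove_range
  have hD' (n : ℕ) : ‖∏ k ∈ range n, (1 - q * q ^ k)‖ ≤ D := hD ⟨n, rfl⟩
  have hC0 : 0 ≤ C := (norm_nonneg _).trans (hC 0)
  have hD0 : 0 ≤ D := (norm_nonneg _).trans (hD' 0)
  refine ⟨D * (C * C), fun n j => ?_⟩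
  rw [qCentralBinom, norm_mul, norm_mul]
  gcongr
  exacts [hD' _, hC _, hC _]

theorem jacobi_triple_product (hx : x ≠ 0) (hq0 : q ≠ 0) (hq : ‖q‖ < 1) :
    theta x q = qPoch q q * qPoch x q * qPoch (q / x) q := by
  obtain ⟨C, hC⟩ := exists_norm_qCentralBinom_le hq
  have hseries : Tendsto (fun n : ℕ => ∑' j : ℤ, qCentralBinom q n j * thetaTerm x q j) atTop
      (𝓝 (∑' j : ℤ, (qPoch q q)⁻¹ * thetaTerm x q j)) := by
    refine tendsto_tsum_of_dominated_convergence (bound := fun j => C * ‖thetaTerm x q j‖)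
      ((summable_norm_thetaTerm hx hq0 hq).mul_left _)
      (fun j => (tendsto_qCentralBinom hq j).mul_const _) (.of_forall fun n j => ?_)
    rw [norm_mul]
    exact mul_le_mul_of_nonneg_right (hC n j) (norm_nonneg _)
  simp only [(hasSum_qCentralBinom_mul_thetaTerm hx hq0 hq _).tsum_eq] at hseries
  have hprod := tendsto_nhds_unique hseries ((tendsto_qPoch x hq).mul (tendsto_qPoch (q / x) hq))
  rw [tsum_mul_left, inv_mul_eq_iff_eq_mul₀ (qPoch_ne_zero hq hq)] at hprod
  rw [mul_assoc]
  exact hprod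

end TripleProduct

section ReciprocalTheta

/-- The `s`-th Laurent coefficient of `(q; q)_∞ ^ 3 / θ(w; q)` on the annulus `‖q‖ < ‖w‖ < 1`. -/
noncomputable def recipCoeff (q : ℂ) (s : ℤ) : ℂ := ∑' r : ℕ, thetaTerm (q ^ (s + 1)) q r

/-- The Laurent expansion of `(q; q)_∞ ^ 3 / θ(w; q)` on the annulus `‖q‖ < ‖w‖ < 1`. -/
noncomputable def recipSeries (q w : ℂ) : ℂ := ∑' s : ℤ, recipCoeff q s * w ^ s

variable {q : ℂ}

lemma hasSum_recipCoeff (hq0 : q ≠ 0) (hq : ‖q‖ < 1) (s : ℤ) :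
    HasSum (fun r : ℕ => thetaTerm (q ^ (s + 1)) q r) (recipCoeff q s) :=
  (summable_norm_thetaTerm_nat (zpow_ne_zero _ hq0) hq0 hq).of_norm.hasSum

lemma thetaTerm_zpow_neg_add_one (hq0 : q ≠ 0) (s r : ℤ) :
    thetaTerm (q ^ (s + 1)) q (-(r + 1)) = -(q ^ (-s) * thetaTerm (q ^ (-s + 1)) q r) := by
  have hdiv : q / q ^ (s + 1) = q ^ (-s) := by
    rw [zpow_add_one₀ hq0, zpow_neg]; field_simp
  rw [thetaTerm_neg hq0, hdiv, thetaTerm_add_one (zpow_ne_zero _ hq0) hq0,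
    zpow_add_one₀ hq0 (-s), thetaTerm_mul]
  ring

/-- `θ` vanishes at `q ^ (s + 1)`, so the negative half of its series sums to `-recipCoeff q s`. -/
lemma hasSum_neg_recipCoeff (hq0 : q ≠ 0) (hq : ‖q‖ < 1) (s : ℤ) :
    HasSum (fun r : ℕ => thetaTerm (q ^ (s + 1)) q (-((r : ℤ) + 1))) (-recipCoeff q s) := by
  have hneg : Summable fun r : ℕ => thetaTerm (q ^ (s + 1)) q (-((r : ℤ) + 1)) :=
    (summable_norm_thetaTerm (zpow_ne_zero (s + 1) hq0) hq0 hq).of_norm.comp_injective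
      (i := fun r : ℕ => -((r : ℤ) + 1)) fun a b hab => by simpa using hab
  have hzero := (HasSum.of_nat_of_neg_add_one (hasSum_recipCoeff hq0 hq s) hneg.hasSum).unique
    (theta_zpow_eq_zero hq0 hq (s + 1) ▸ hasSum_theta (zpow_ne_zero _ hq0) hq0 hq)
  rw [← eq_neg_of_add_eq_zero_right hzero]
  exact hneg.hasSum

lemma recipCoeff_eq_zpow_mul_neg (hq0 : q ≠ 0) (hq : ‖q‖ < 1) (s : ℤ) :
    recipCoeff q s = q ^ (-s) * recipCoeff q (-s) := by
  have hneg := hasSum_neg_recipCoeff hq0 hq s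
  simp only [thetaTerm_zpow_neg_add_one hq0] at hneg
  exact neg_injective (hneg.unique ((hasSum_recipCoeff hq0 hq (-s)).mul_left (q ^ (-s))).neg)

lemma recipCoeff_eq_one_sub (hq0 : q ≠ 0) (hq : ‖q‖ < 1) (s : ℤ) :
    recipCoeff q s = 1 - q ^ (s + 1) * recipCoeff q (s + 1) := by
  have hshift (r : ℕ) : thetaTerm (q ^ (s + 1)) q (r + 1 : ℕ) =
      -(q ^ (s + 1) * thetaTerm (q ^ (s + 1 + 1)) q r) := by
    rw [Nat.cast_succ, thetaTerm_add_one (zpow_ne_zero _ hq0) hq0, zpow_add_one₀ hq0 (s + 1),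
      thetaTerm_mul]
    ring
  have htail := (hasSum_nat_add_iff' 1).2 (hasSum_recipCoeff hq0 hq s)
  simp only [hshift] at htail
  have heq := htail.unique ((hasSum_recipCoeff hq0 hq (s + 1)).mul_left (q ^ (s + 1))).neg
  simp only [thetaTerm, range_one, sum_singleton, Nat.cast_zero, zpow_zero, zero_mul, one_mul,
    Int.zero_ediv] at heq
  linear_combination heq

lemma norm_thetaTerm_zpow_le (hq0 : q ≠ 0) (hq : ‖q‖ < 1) {s : ℤ} (hs : 0 ≤ s) (r : ℕ) :
    ‖thetaTerm (q ^ (s + 1)) q r‖ ≤ ‖thetaTerm q q r‖ := by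
  have hpow : ‖q ^ s‖ ^ r ≤ 1 := by
    rw [norm_zpow]
    exact pow_le_one₀ (by positivity) (zpow_le_one₀ (norm_pos_iff.2 hq0) hq.le hs)
  rw [zpow_add_one₀ hq0, mul_comm, thetaTerm_mul, norm_mul, zpow_natCast, norm_pow]
  exact mul_le_of_le_one_right (norm_nonneg _) hpow

lemma exists_norm_recipCoeff_le (hq0 : q ≠ 0) (hq : ‖q‖ < 1) :
    ∃ C, ∀ s : ℤ, ‖recipCoeff q s‖ ≤ C ∧ ‖recipCoeff q s‖ ≤ C * ‖q‖ ^ (-s) := by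
  obtain ⟨C, hC⟩ : ∃ C, ∀ s : ℤ, 0 ≤ s → ‖recipCoeff q s‖ ≤ C :=
    ⟨_, fun s hs => tsum_of_norm_bounded (summable_norm_thetaTerm_nat hq0 hq0 hq).hasSum
      fun r => norm_thetaTerm_zpow_le hq0 hq hs r⟩
  have hC0 : 0 ≤ C := (norm_nonneg _).trans (hC 0 le_rfl)
  refine ⟨C, fun s => ?_⟩
  rcases le_total 0 s with hs | hs
  · refine ⟨hC s hs, (hC s hs).trans (le_mul_of_one_le_right hC0 ?_)⟩
    exact one_le_zpow_of_nonpos₀ (norm_pos_iff.2 hq0) hq.le (neg_nonpos.2 hs)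
  · have hle : ‖recipCoeff q s‖ ≤ C * ‖q‖ ^ (-s) := by
      rw [recipCoeff_eq_zpow_mul_neg hq0 hq, norm_mul, norm_zpow, mul_comm]
      exact mul_le_mul_of_nonneg_right (hC _ (neg_nonneg.2 hs)) (by positivity)
    refine ⟨hle.trans (mul_le_of_le_one_right hC0 ?_), hle⟩
    exact zpow_le_one₀ (norm_pos_iff.2 hq0) hq.le (neg_nonneg.2 hs)

lemma summable_norm_recipCoeff_mul_zpow (hq0 : q ≠ 0) (hq : ‖q‖ < 1) {w : ℂ} (hqw : ‖q‖ < ‖w‖)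
    (hw : ‖w‖ < 1) : Summable fun s : ℤ => ‖recipCoeff q s * w ^ s‖ := by
  obtain ⟨C, hC⟩ := exists_norm_recipCoeff_le hq0 hq
  have hw0 : 0 < ‖w‖ := (norm_nonneg _).trans_lt hqw
  have hpos := (summable_geometric_of_lt_one hw0.le hw).mul_left C
  have hneg := (summable_geometric_of_lt_one (by positivity) ((div_lt_one hw0).2 hqw)).mul_left C
  refine (hpos.of_nonneg_of_le (fun _ => norm_nonneg _) fun s => ?_).of_nat_of_neg
    (hneg.of_nonneg_of_le (fun _ => norm_nonneg _) fun s => ?_)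
  · rw [norm_mul, zpow_natCast, norm_pow]
    exact mul_le_mul_of_nonneg_right (hC s).1 (by positivity)
  · have hle := (hC (-s)).2
    rw [neg_neg, zpow_natCast] at hle
    rw [norm_mul, zpow_neg, zpow_natCast, norm_inv, norm_pow, div_pow, div_eq_mul_inv, ← mul_assoc]
    exact mul_le_mul_of_nonneg_right hle (by positivity)

lemma summable_norm_thetaTerm_mul_recipCoeff (hq0 : q ≠ 0) (hq : ‖q‖ < 1) {x Q : ℂ} (hx : x ≠ 0)
    (hQ0 : Q ≠ 0) (hQ : ‖Q‖ < 1) (e : ℤ → ℤ) :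
    Summable fun n : ℤ => ‖thetaTerm x Q n * recipCoeff q (e n)‖ := by
  obtain ⟨C, hC⟩ := exists_norm_recipCoeff_le hq0 hq
  refine ((summable_norm_thetaTerm hx hQ0 hQ).mul_right C).of_nonneg_of_le
    (fun _ => norm_nonneg _) fun n => ?_
  rw [norm_mul]
  exact mul_le_mul_of_nonneg_left (hC _).1 (norm_nonneg _)

lemma one_sub_mul_tsum_thetaTerm_mul_recipCoeff (hq0 : q ≠ 0) (hq : ‖q‖ < 1) {w : ℂ} (hw : w ≠ 0)
    (N : ℤ) : (1 - q ^ N * w) * ∑' n : ℤ, thetaTerm w q n * recipCoeff q (N - n) = theta w q := by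
  have hsum := (summable_norm_thetaTerm_mul_recipCoeff hq0 hq hw hq0 hq (N - ·)).of_norm.hasSum
  have hrec (n : ℤ) : thetaTerm w q n * recipCoeff q (N - n) = thetaTerm w q n +
      q ^ N * w * (thetaTerm w q (n - 1) * recipCoeff q (N - (n - 1))) := by
    rw [recipCoeff_eq_one_sub hq0 hq, show N - (n - 1) = N - n + 1 by ring,
      show thetaTerm w q n = -w * q ^ (n - 1) * thetaTerm w q (n - 1) by
        rw [← thetaTerm_add_one hw hq0, sub_add_cancel],
      show q ^ N = q ^ (n - 1) * q ^ (N - n + 1) by rw [← zpow_add₀ hq0]; congr 1; ring]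
    ring
  have hshift := (hasSum_theta hw hq0 hq).add
    (((Equiv.subRight (1 : ℤ)).hasSum_iff.2 hsum).mul_left (q ^ N * w))
  have heq := hsum.unique (hshift.congr_fun fun n => hrec n)
  linear_combination heq

lemma tsum_thetaTerm_one_mul_recipCoeff_sub (hq0 : q ≠ 0) (hq : ‖q‖ < 1) {N : ℤ} (hN : N ≠ 0) :
    ∑' n : ℤ, thetaTerm 1 q n * recipCoeff q (N - n) = 0 := by
  have hmul := one_sub_mul_tsum_thetaTerm_mul_recipCoeff hq0 hq one_ne_zero N
  rw [mul_one, ← zpow_zero q, theta_zpow_eq_zero hq0 hq, zpow_zero] at hmul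
  refine (mul_eq_zero.1 hmul).resolve_left (sub_ne_zero.2 fun h => hN ?_)
  rw [← zpow_eq_one_iff_right₀ (norm_nonneg q) hq.ne, ← norm_zpow, ← h, norm_one]

lemma norm_thetaTerm_le_add {a b w : ℂ} (ha : a ≠ 0) (haw : ‖a‖ ≤ ‖w‖) (hwb : ‖w‖ ≤ ‖b‖)
    (n : ℤ) : ‖thetaTerm w q n‖ ≤ ‖thetaTerm a q n‖ + ‖thetaTerm b q n‖ := by
  have hpow : ‖w‖ ^ n ≤ ‖a‖ ^ n + ‖b‖ ^ n := by
    rcases le_total 0 n with hn | hn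
    · exact le_add_of_nonneg_of_le (by positivity) (zpow_le_zpow_left₀ hn (norm_nonneg _) hwb)
    · refine le_add_of_le_of_nonneg ?_ (by positivity)
      simpa only [inv_zpow', neg_neg] using zpow_le_zpow_left₀ (neg_nonneg.2 hn)
        (inv_nonneg.2 (norm_nonneg w)) (inv_anti₀ (norm_pos_iff.2 ha) haw)
  simp only [thetaTerm, norm_mul, norm_zpow, ← mul_add]
  exact mul_le_mul_of_nonneg_left hpow (by positivity)

lemma continuousAt_tsum_thetaTerm_mul (hq0 : q ≠ 0) (hq : ‖q‖ < 1) {c : ℤ → ℂ} {C : ℝ}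
    (hc : ∀ n, ‖c n‖ ≤ C) {w : ℂ} (hw : w ≠ 0) :
    ContinuousAt (fun w => ∑' n : ℤ, thetaTerm w q n * c n) w := by
  have hw_pos : 0 < ‖w‖ := norm_pos_iff.2 hw
  have hnorm2 : ‖w * 2‖ = ‖w‖ * 2 := by simp
  have hnorm_half : ‖w / 2‖ = ‖w‖ / 2 := by simp
  refine tendsto_tsum_of_dominated_convergence
    (bound := fun n => (‖thetaTerm (w / 2) q n‖ + ‖thetaTerm (w * 2) q n‖) * C)
    (((summable_norm_thetaTerm (div_ne_zero hw two_ne_zero) hq0 hq).add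
      (summable_norm_thetaTerm (mul_ne_zero hw two_ne_zero) hq0 hq)).mul_right C)
    (fun n => ((continuousAt_zpow₀ w n (Or.inl hw)).const_mul _).mul_const _) ?_
  filter_upwards [(continuous_norm.tendsto w).eventually_const_le (half_lt_self hw_pos),
    (continuous_norm.tendsto w).eventually_le_const (lt_mul_of_one_lt_right hw_pos one_lt_two)]
    with z hz1 hz2 n
  rw [norm_mul]
  exact mul_le_mul (norm_thetaTerm_le_add (div_ne_zero hw two_ne_zero) (hnorm_half ▸ hz1)
    (hnorm2 ▸ hz2) n) (hc n) (norm_nonneg _) (by positivity)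

lemma tsum_thetaTerm_one_mul_recipCoeff_neg (hq0 : q ≠ 0) (hq : ‖q‖ < 1) :
    ∑' n : ℤ, thetaTerm 1 q n * recipCoeff q (-n) = qPoch q q ^ 3 := by
  obtain ⟨C, hC⟩ := exists_norm_recipCoeff_le hq0 hq
  have hseries := continuousAt_tsum_thetaTerm_mul hq0 hq (c := fun n => recipCoeff q (-n))
    (fun n => (hC (-n)).1) one_ne_zero
  have hprod : ContinuousAt (fun w => qPoch q q * qPoch (w * q) q * qPoch (q / w) q) 1 :=
    (continuousAt_const.mul ((continuous_qPoch hq).continuousAt.comp' (by fun_prop))).mul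
      ((continuous_qPoch hq).continuousAt.comp'
        (continuousAt_const.div₀ continuousAt_id one_ne_zero))
  suffices heq : (fun w => ∑' n : ℤ, thetaTerm w q n * recipCoeff q (-n)) =ᶠ[𝓝[≠] 1]
      fun w => qPoch q q * qPoch (w * q) q * qPoch (q / w) q by
    refine (tendsto_nhds_unique (hseries.mono_left nhdsWithin_le_nhds)
      ((hprod.mono_left nhdsWithin_le_nhds).congr' heq.symm)).trans ?_
    simp only [one_mul, div_one]
    ring
  filter_upwards [nhdsWithin_le_nhds (isOpen_ne.mem_nhds one_ne_zero), self_mem_nhdsWithin]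
    with w hw0 hw1
  refine mul_left_cancel₀ (sub_ne_zero.2 (Ne.symm hw1)) ?_
  have hmul := one_sub_mul_tsum_thetaTerm_mul_recipCoeff hq0 hq hw0 0
  simp only [zpow_zero, one_mul, zero_sub] at hmul
  rw [hmul, jacobi_triple_product hw0 hq0 hq, qPoch_eq_one_sub_mul w hq]
  ring

theorem theta_mul_recipSeries (hq0 : q ≠ 0) (hq : ‖q‖ < 1) {w : ℂ} (hqw : ‖q‖ < ‖w‖)
    (hw : ‖w‖ < 1) : theta w q * recipSeries q w = qPoch q q ^ 3 := by
  have hw0 : w ≠ 0 := norm_pos_iff.1 ((norm_nonneg _).trans_lt hqw)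
  have htheta := summable_norm_thetaTerm hw0 hq0 hq
  have hrecip := summable_norm_recipCoeff_mul_zpow hq0 hq hqw hw
  let e : ℤ × ℤ ≃ ℤ × ℤ := (Equiv.prodComm ℤ ℤ).trans ((Equiv.refl ℤ).prodShear Equiv.subRight)
  have hterm (N n : ℤ) : thetaTerm w q n * (recipCoeff q (N - n) * w ^ (N - n)) =
      w ^ N * (thetaTerm 1 q n * recipCoeff q (N - n)) := by
    rw [← one_mul w, thetaTerm_mul, one_mul, zpow_sub₀ hw0]
    have := zpow_ne_zero n hw0
    field_simp
  calc theta w q * recipSeries q w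
      = ∑' p : ℤ × ℤ, thetaTerm w q p.1 * (recipCoeff q p.2 * w ^ p.2) :=
        tsum_mul_tsum_of_summable_norm htheta hrecip
    _ = ∑' p : ℤ × ℤ, thetaTerm w q p.2 * (recipCoeff q (p.1 - p.2) * w ^ (p.1 - p.2)) :=
        (e.tsum_eq _).symm
    _ = ∑' N : ℤ, w ^ N * ∑' n : ℤ, thetaTerm 1 q n * recipCoeff q (N - n) := by
        refine (e.summable_iff.2 (summable_mul_of_summable_norm htheta hrecip)).tsum_prod.trans ?_
        exact tsum_congr fun N => (tsum_congr fun n => hterm N n).trans tsum_mul_left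
    _ = ∑' n : ℤ, thetaTerm 1 q n * recipCoeff q (-n) := by
        rw [tsum_eq_single 0 fun N hN => by
          rw [tsum_thetaTerm_one_mul_recipCoeff_sub hq0 hq hN, mul_zero]]
        simp only [zpow_zero, one_mul, zero_sub]
    _ = qPoch q q ^ 3 := tsum_thetaTerm_one_mul_recipCoeff_neg hq0 hq

end ReciprocalTheta

section ConstantTerm

open Complex MeasureTheory intervalIntegral

lemma integral_exp_two_pi_mul_I_zpow (d : ℤ) :
    ∫ x in (0 : ℝ)..1, exp (2 * Real.pi * I * (x : ℂ)) ^ d = if d = 0 then 1 else 0 := by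
  split_ifs with hd
  · simp [hd]
  · have hc : 2 * Real.pi * I * (d : ℂ) ≠ 0 := by simp [hd, Real.pi_ne_zero]
    have hzpow (x : ℝ) : exp (2 * Real.pi * I * (x : ℂ)) ^ d =
        exp (2 * Real.pi * I * (d : ℂ) * (x : ℂ)) := by
      rw [← exp_int_mul]; ring_nf
    have hperiod : exp (2 * Real.pi * I * (d : ℂ) * ((1 : ℝ) : ℂ)) = 1 :=
      exp_eq_one_iff.2 ⟨d, by push_cast; ring⟩
    simp_rw [hzpow]
    rw [integral_exp_mul_complex hc, hperiod]
    simp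

lemma integral_tsum_mul_exp_zpow {ι : Type*} [Countable ι] (c : ι → ℂ) (d : ι → ℤ)
    (hc : Summable fun i => ‖c i‖) :
    ∫ x in (0 : ℝ)..1, ∑' i, c i * exp (2 * Real.pi * I * (x : ℂ)) ^ d i =
      ∑' i, if d i = 0 then c i else 0 := by
  have hnorm (x : ℝ) : ‖exp (2 * Real.pi * I * (x : ℂ))‖ = 1 := by simp [norm_exp]
  have hcont (i : ι) : Continuous fun x : ℝ => c i * exp (2 * Real.pi * I * (x : ℂ)) ^ d i :=
    continuous_const.mul (Continuous.zpow₀ (by fun_prop) _ fun x => Or.inl (exp_ne_zero _))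
  have hswap := tsum_intervalIntegral_eq_of_summable_norm (a := 0) (b := 1)
    (f := fun i => (⟨_, hcont i⟩ : C(ℝ, ℂ))) (Summable.of_nonneg_of_le (fun _ => norm_nonneg _)
      (fun i => (ContinuousMap.norm_le _ (norm_nonneg (c i))).2 fun x => by simp [hnorm]) hc)
  simp only [ContinuousMap.coe_mk] at hswap
  rw [← hswap]
  refine tsum_congr fun i => ?_
  rw [intervalIntegral.integral_const_mul, integral_exp_two_pi_mul_I_zpow]
  simp

lemma constantTerm_eq_of_eq_on_circle {ι κ : Type*} [Countable ι] [Countable κ] {c : ι → ℂ}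
    {d : ι → ℤ} {c' : κ → ℂ} {d' : κ → ℤ} (hc : Summable fun i => ‖c i‖)
    (hc' : Summable fun k => ‖c' k‖)
    (h : ∀ z : ℂ, ‖z‖ = 1 → ∑' i, c i * z ^ d i = ∑' k, c' k * z ^ d' k) :
    (∑' i, if d i = 0 then c i else 0) = ∑' k, if d' k = 0 then c' k else 0 := by
  rw [← integral_tsum_mul_exp_zpow c d hc, ← integral_tsum_mul_exp_zpow c' d' hc']
  exact intervalIntegral.integral_congr fun x _ => h _ (by simp [norm_exp])

end ConstantTerm

section HeckeSum

/-- The bijection `(r, s) ↦ (r, s)` that indexes the first part of a Hecke-type double-sum by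
pairs of natural numbers. -/
def natEquivNonnegPairs : ℕ × ℕ ≃ nonnegPairs where
  toFun p := ⟨(p.1, p.2), Int.natCast_nonneg _, Int.natCast_nonneg _⟩
  invFun p := (p.1.1.toNat, p.1.2.toNat)
  left_inv p := by simp
  right_inv := by
    rintro ⟨⟨r, s⟩, hr, hs⟩
    exact Subtype.ext (Prod.ext (Int.toNat_of_nonneg hr) (Int.toNat_of_nonneg hs))

/-- The bijection `(r, s) ↦ (-(r + 1), -(s + 1))` that indexes the second part of a Hecke-type
double-sum by pairs of natural numbers. -/
def natEquivNegPairs : ℕ × ℕ ≃ negPairs where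
  toFun p := ⟨(-((p.1 : ℤ) + 1), -((p.2 : ℤ) + 1)), by constructor <;> dsimp only <;> omega⟩
  invFun p := ((-p.1.1 - 1).toNat, (-p.1.2 - 1).toNat)
  left_inv p := by ext <;> simp
  right_inv := by
    rintro ⟨⟨r, s⟩, hr, hs⟩
    dsimp only at hr hs
    refine Subtype.ext (Prod.ext ?_ ?_) <;> dsimp only <;> omega

variable {q y : ℂ} {a c : ℕ}

lemma heckeTerm_eq_thetaTerm_mul (hq0 : q ≠ 0) (a c : ℕ) (y : ℂ) (r s : ℤ) :
    heckeTerm a a c (q ^ a) y q (r, s) =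
      thetaTerm y (q ^ c) s * thetaTerm ((q ^ a) ^ (s + 1)) (q ^ a) r := by
  have hcross : q ^ ((a : ℤ) * r * s) = ((q ^ a) ^ s) ^ r := by
    simp only [← zpow_natCast, ← zpow_mul]; congr 1; ring
  simp only [heckeTerm]
  rw [zpow_add₀ (by norm_num : (-1 : ℂ) ≠ 0), zpow_add₀ hq0, zpow_add₀ hq0, hcross, zpow_mul,
    zpow_mul q (c : ℤ), zpow_natCast, zpow_natCast, zpow_add_one₀ (pow_ne_zero a hq0), thetaTerm,
    thetaTerm, mul_zpow]
  ring

lemma summable_heckeTerm_nat (hq0 : q ≠ 0) (hq : ‖q‖ < 1) (ha : a ≠ 0) (hc : c ≠ 0)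
    (hy : y ≠ 0) : Summable fun p : ℕ × ℕ => ‖heckeTerm a a c (q ^ a) y q (p.1, p.2)‖ := by
  have hqa0 := pow_ne_zero a hq0
  have hqa := norm_pow_lt_one hq ha
  refine ((summable_norm_thetaTerm_nat hqa0 hqa0 hqa).mul_of_nonneg
    (summable_norm_thetaTerm_nat hy (pow_ne_zero c hq0) (norm_pow_lt_one hq hc))
    (fun _ => norm_nonneg _) fun _ => norm_nonneg _).of_nonneg_of_le
    (fun _ => norm_nonneg _) fun p => ?_
  rw [heckeTerm_eq_thetaTerm_mul hq0, norm_mul, mul_comm]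
  exact mul_le_mul_of_nonneg_right
    (norm_thetaTerm_zpow_le hqa0 hqa (Int.natCast_nonneg _) _) (norm_nonneg _)

lemma summable_heckeTerm_neg_nat (hq0 : q ≠ 0) (hq : ‖q‖ < 1) (ha : a ≠ 0) (hc : c ≠ 0)
    (hy : y ≠ 0) : Summable fun p : ℕ × ℕ =>
      ‖heckeTerm a a c (q ^ a) y q (-((p.1 : ℤ) + 1), -((p.2 : ℤ) + 1))‖ := by
  have hqa0 := pow_ne_zero a hq0
  have hqa := norm_pow_lt_one hq ha
  have hneg : Summable fun s : ℕ => ‖thetaTerm y (q ^ c) (-((s : ℤ) + 1))‖ :=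
    (summable_norm_thetaTerm hy (pow_ne_zero c hq0) (norm_pow_lt_one hq hc)).comp_injective
      (i := fun s : ℕ => -((s : ℤ) + 1)) fun _ _ h => by simpa using h
  refine ((summable_norm_thetaTerm_nat hqa0 hqa0 hqa).mul_of_nonneg hneg
    (fun _ => norm_nonneg _) fun _ => norm_nonneg _).of_nonneg_of_le
    (fun _ => norm_nonneg _) fun p => ?_
  have hs : (0 : ℤ) ≤ (p.2 : ℤ) + 1 := by positivity
  have hpow : ‖(q ^ a) ^ ((p.2 : ℤ) + 1)‖ ≤ 1 := by
    rw [norm_zpow]; exact zpow_le_one₀ (norm_pos_iff.2 hqa0) hqa.le hs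
  rw [heckeTerm_eq_thetaTerm_mul hq0, norm_mul, mul_comm, thetaTerm_zpow_neg_add_one hqa0, norm_neg,
    norm_mul, neg_neg]
  exact mul_le_mul_of_nonneg_right ((mul_le_of_le_one_left (norm_nonneg _) hpow).trans
    (norm_thetaTerm_zpow_le hqa0 hqa hs p.1)) (norm_nonneg _)

lemma heckeSummable (hq0 : q ≠ 0) (hq : ‖q‖ < 1) (ha : a ≠ 0) (hc : c ≠ 0) (hy : y ≠ 0) :
    HeckeSummable a a c (q ^ a) y q :=
  ⟨natEquivNonnegPairs.summable_iff.1 (summable_heckeTerm_nat hq0 hq ha hc hy).of_norm,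
    natEquivNegPairs.summable_iff.1 (summable_heckeTerm_neg_nat hq0 hq ha hc hy).of_norm⟩

theorem heckeSum_eq_tsum_recipCoeff (hq0 : q ≠ 0) (hq : ‖q‖ < 1) (ha : a ≠ 0) (hc : c ≠ 0)
    (hy : y ≠ 0) : heckeSum a a c (q ^ a) y q =
      ∑' s : ℤ, thetaTerm y (q ^ c) s * recipCoeff (q ^ a) s := by
  have hqa0 := pow_ne_zero a hq0
  have hqa := norm_pow_lt_one hq ha
  obtain ⟨hsum_nonneg, hsum_neg⟩ := heckeSummable hq0 hq ha hc hy
  have hnonneg : HasSum (fun s : ℕ => thetaTerm y (q ^ c) s * recipCoeff (q ^ a) s)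
      (∑' p : nonnegPairs, heckeTerm a a c (q ^ a) y q p) :=
    (((Equiv.prodComm ℕ ℕ).trans natEquivNonnegPairs).hasSum_iff.2
      hsum_nonneg.hasSum).prod_fiberwise
      fun s => ((hasSum_recipCoeff hqa0 hqa s).mul_left _).congr_fun
        fun r => heckeTerm_eq_thetaTerm_mul hq0 a c y r s
  have hneg : HasSum (fun s : ℕ =>
        thetaTerm y (q ^ c) (-((s : ℤ) + 1)) * recipCoeff (q ^ a) (-((s : ℤ) + 1)))
      (-∑' p : negPairs, heckeTerm a a c (q ^ a) y q p) := by
    refine (((Equiv.prodComm ℕ ℕ).trans natEquivNegPairs).hasSum_iff.2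
      hsum_neg.hasSum).neg.prod_fiberwise fun s => ?_
    have hrow := ((hasSum_neg_recipCoeff hqa0 hqa (-((s : ℤ) + 1))).mul_left
      (thetaTerm y (q ^ c) (-((s : ℤ) + 1)))).neg
    rw [mul_neg, neg_neg] at hrow
    exact hrow.congr_fun fun r => congrArg Neg.neg (heckeTerm_eq_thetaTerm_mul hq0 a c y _ _)
  exact (HasSum.of_nat_of_neg_add_one
    (f := fun s : ℤ => thetaTerm y (q ^ c) s * recipCoeff (q ^ a) s) hnonneg hneg).tsum_eq.symm

end HeckeSum

section ConstantTermEvaluation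

variable {q : ℂ}

lemma theta_factorization (hq0 : q ≠ 0) (hq : ‖q‖ < 1) {z : ℂ} (hz : z ≠ 0) :
    qPoch (q ^ 2) (q ^ 2) * qPoch (q ^ 6) (q ^ 6) ^ 3 * theta z q =
      qPoch q q * theta (z * q) (q ^ 2) * theta z (q ^ 6) * theta (q ^ 4 / z) (q ^ 6) *
        theta (z * q ^ 4) (q ^ 6) := by
  have hq2 : ‖q ^ 2‖ < 1 := norm_pow_lt_one hq two_ne_zero
  have hq6 : ‖q ^ 6‖ < 1 := norm_pow_lt_one hq (by norm_num)
  have split_two (x : ℂ) : qPoch x q = qPoch x (q ^ 2) * qPoch (x * q) (q ^ 2) := by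
    simpa [prod_range_succ] using qPoch_eq_prod_range x hq two_ne_zero
  have split_three (x : ℂ) : qPoch x (q ^ 2) =
      qPoch x (q ^ 6) * qPoch (x * q ^ 2) (q ^ 6) * qPoch (x * q ^ 4) (q ^ 6) := by
    simpa [prod_range_succ, ← pow_mul] using qPoch_eq_prod_range x hq2 three_ne_zero
  have harg₁ : q ^ 2 / (z * q) = q / z := by field_simp
  have harg₂ : q ^ 6 / (q ^ 4 / z) = z * q ^ 2 := by field_simp
  have harg₃ : q ^ 6 / (z * q ^ 4) = q / z * q := by field_simp
  have harg₄ : q / z * q * q ^ 2 = q ^ 4 / z := by field_simp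
  have harg₅ : q / z * q * q ^ 4 = q ^ 6 / z := by field_simp
  rw [jacobi_triple_product hz hq0 hq,
    jacobi_triple_product (mul_ne_zero hz hq0) (pow_ne_zero 2 hq0) hq2,
    jacobi_triple_product hz (pow_ne_zero 6 hq0) hq6,
    jacobi_triple_product (div_ne_zero (pow_ne_zero 4 hq0) hz) (pow_ne_zero 6 hq0) hq6,
    jacobi_triple_product (mul_ne_zero hz (pow_ne_zero 4 hq0)) (pow_ne_zero 6 hq0) hq6,
    split_two z, split_two (q / z), split_three z, split_three (q / z * q), harg₁, harg₂, harg₃,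
    harg₄, harg₅]
  ring

/-- The positive definite binary theta series that arises as the constant term in `z` of
`j(zq; q²) j(z; q⁶) j(zq⁴; q⁶)`. -/
noncomputable def binaryTheta (q : ℂ) : ℂ :=
  ∑' p : ℤ × ℤ, q ^ (4 * p.1 ^ 2 + 2 * p.1 * p.2 + 4 * p.2 ^ 2 - 3 * p.1 + p.2)

lemma thetaTerm_pow_pow (hq0 : q ≠ 0) (a m : ℕ) (n : ℤ) :
    thetaTerm (q ^ a) (q ^ m) n = (-1 : ℂ) ^ n * q ^ (m * (n * (n - 1) / 2) + a * n) := by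
  rw [thetaTerm, zpow_add₀ hq0, zpow_mul, zpow_mul, zpow_natCast, zpow_natCast, mul_assoc]

lemma tsum_ite_eq_tsum_comp {ι κ M : Type*} [AddCommMonoid M] [TopologicalSpace M] {P : ι → Prop}
    [DecidablePred P] {e : κ → ι} (he : e.Injective) (hP : ∀ i, P i ↔ i ∈ Set.range e)
    (F : ι → M) : (∑' i, if P i then F i else 0) = ∑' k, F (e k) := by
  rw [← he.tsum_eq fun i hi => (hP i).1 (by_contra fun h => hi (if_neg h))]
  exact tsum_congr fun k => if_pos ((hP _).2 ⟨k, rfl⟩)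

lemma thetaTerm_neg_add_mul_thetaTerm_mul_thetaTerm (hq0 : q ≠ 0) (m n : ℤ) :
    thetaTerm q (q ^ 2) (-(m + n)) * (thetaTerm 1 (q ^ 6) m * thetaTerm (q ^ 4) (q ^ 6) n) =
      q ^ (4 * m ^ 2 + 2 * m * n + 4 * n ^ 2 - 3 * m + n) := by
  have hsign : (-1 : ℂ) ^ (-(m + n)) * ((-1 : ℂ) ^ m * (-1 : ℂ) ^ n) = 1 := by
    rw [← zpow_add₀ (by norm_num), ← zpow_add₀ (by norm_num), neg_add_cancel, zpow_zero]
  have hexp : 4 * m ^ 2 + 2 * m * n + 4 * n ^ 2 - 3 * m + n =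
      (2 * (-(m + n) * (-(m + n) - 1) / 2) + -(m + n)) +
        (6 * (m * (m - 1) / 2) + (6 * (n * (n - 1) / 2) + 4 * n)) := by
    linarith [two_mul_triangle (-(m + n)), two_mul_triangle m, two_mul_triangle n]
  have hfst := thetaTerm_pow_pow hq0 1 2 (-(m + n))
  have hsnd := thetaTerm_pow_pow hq0 0 6 m
  have htrd := thetaTerm_pow_pow hq0 4 6 n
  simp only [pow_one, pow_zero, Nat.cast_one, Nat.cast_ofNat, Nat.cast_zero, one_mul, zero_mul,
    add_zero] at hfst hsnd htrd
  rw [hfst, hsnd, htrd, hexp, zpow_add₀ hq0 (_ + _), zpow_add₀ hq0 (6 * (m * (m - 1) / 2)),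
    mul_mul_mul_comm ((-1) ^ m), mul_mul_mul_comm, hsign, one_mul]

lemma tsum_laurent_theta_mul_recipSeries (hq0 : q ≠ 0) (hq : ‖q‖ < 1) {Q w z : ℂ} (hQ0 : Q ≠ 0)
    (hQ : ‖Q‖ < 1) (hz : z ≠ 0) (hQw : ‖Q‖ < ‖w / z‖) (hw : ‖w / z‖ < 1) :
    ∑' p : ℤ × ℤ, thetaTerm 1 q p.1 * (recipCoeff Q p.2 * w ^ p.2) * z ^ (p.1 - p.2) =
      theta z q * recipSeries Q (w / z) := by
  rw [theta, recipSeries]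
  refine .trans ?_ (tsum_mul_tsum_of_summable_norm (summable_norm_thetaTerm hz hq0 hq)
    (summable_norm_recipCoeff_mul_zpow hQ0 hQ hQw hw)).symm
  refine tsum_congr fun p => ?_
  rw [div_zpow, zpow_sub₀ hz, ← one_mul z, thetaTerm_mul, one_mul]
  ring

lemma tsum_laurent_theta_mul_theta_mul_theta {x₁ x₂ x₃ q₁ q₂ q₃ z : ℂ} (hx₁ : x₁ ≠ 0)
    (hx₂ : x₂ ≠ 0) (hx₃ : x₃ ≠ 0) (hq₁0 : q₁ ≠ 0) (hq₁ : ‖q₁‖ < 1) (hq₂0 : q₂ ≠ 0) (hq₂ : ‖q₂‖ < 1)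
    (hq₃0 : q₃ ≠ 0) (hq₃ : ‖q₃‖ < 1) (hz : z ≠ 0) :
    ∑' p : ℤ × ℤ × ℤ, thetaTerm x₁ q₁ p.1 * (thetaTerm x₂ q₂ p.2.1 * thetaTerm x₃ q₃ p.2.2) *
        z ^ (p.1 + p.2.1 + p.2.2) =
      theta (x₁ * z) q₁ * (theta (x₂ * z) q₂ * theta (x₃ * z) q₃) := by
  have hsum₁ := summable_norm_thetaTerm (mul_ne_zero hx₁ hz) hq₁0 hq₁
  have hsum₂ := summable_norm_thetaTerm (mul_ne_zero hx₂ hz) hq₂0 hq₂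
  have hsum₃ := summable_norm_thetaTerm (mul_ne_zero hx₃ hz) hq₃0 hq₃
  rw [theta, theta, theta]
  refine .trans ?_ ((tsum_mul_tsum_of_summable_norm hsum₁ (hsum₂.mul_norm hsum₃)).symm.trans
    (congrArg _ (tsum_mul_tsum_of_summable_norm hsum₂ hsum₃).symm))
  refine tsum_congr fun p => ?_
  rw [thetaTerm_mul, thetaTerm_mul, thetaTerm_mul, zpow_add₀ hz, zpow_add₀ hz]
  ring

lemma norm_pow_six_lt_norm_pow_four (hq0 : q ≠ 0) (hq : ‖q‖ < 1) : ‖q ^ 6‖ < ‖q ^ 4‖ := by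
  rw [norm_pow, norm_pow]
  exact pow_lt_pow_right_of_lt_one₀ (norm_pos_iff.2 hq0) hq (by norm_num)

lemma theta_mul_recipSeries_eq_theta_mul_theta_mul_theta (hq0 : q ≠ 0) (hq : ‖q‖ < 1) {z : ℂ}
    (hz : ‖z‖ = 1) :
    qPoch (q ^ 2) (q ^ 2) * (theta z q * recipSeries (q ^ 6) (q ^ 4 / z)) =
      qPoch q q * (theta (q * z) (q ^ 2) * (theta z (q ^ 6) * theta (q ^ 4 * z) (q ^ 6))) := by
  have hz0 : z ≠ 0 := norm_pos_iff.1 (hz ▸ one_pos)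
  have hq6 : ‖q ^ 6‖ < 1 := norm_pow_lt_one hq (by norm_num)
  have hnorm : ‖q ^ 4 / z‖ = ‖q ^ 4‖ := by rw [norm_div, hz, div_one]
  have hrecip := theta_mul_recipSeries (pow_ne_zero 6 hq0) hq6
    (hnorm ▸ norm_pow_six_lt_norm_pow_four hq0 hq) (hnorm ▸ norm_pow_lt_one hq (by norm_num))
  have hfactor := theta_factorization hq0 hq hz0
  rw [mul_comm z q, mul_comm z (q ^ 4)] at hfactor
  refine mul_left_cancel₀ (pow_ne_zero 3 (qPoch_ne_zero hq6 hq6)) ?_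
  linear_combination recipSeries (q ^ 6) (q ^ 4 / z) * hfactor + qPoch q q *
    theta (q * z) (q ^ 2) * theta z (q ^ 6) * theta (q ^ 4 * z) (q ^ 6) * hrecip

lemma qPoch_mul_tsum_thetaTerm_mul_recipCoeff (hq0 : q ≠ 0) (hq : ‖q‖ < 1) :
    qPoch (q ^ 2) (q ^ 2) * ∑' s : ℤ, thetaTerm 1 q s * (recipCoeff (q ^ 6) s * (q ^ 4) ^ s) =
      qPoch q q * binaryTheta q := by
  have hq2 : ‖q ^ 2‖ < 1 := norm_pow_lt_one hq two_ne_zero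
  have hq4 : ‖q ^ 4‖ < 1 := norm_pow_lt_one hq (by norm_num)
  have hq6 : ‖q ^ 6‖ < 1 := norm_pow_lt_one hq (by norm_num)
  have hq64 := norm_pow_six_lt_norm_pow_four hq0 hq
  have hq20 := pow_ne_zero 2 hq0
  have hq40 := pow_ne_zero 4 hq0
  have hq60 := pow_ne_zero 6 hq0
  have hconst := constantTerm_eq_of_eq_on_circle
    (c := fun p : ℤ × ℤ => qPoch (q ^ 2) (q ^ 2) *
      (thetaTerm 1 q p.1 * (recipCoeff (q ^ 6) p.2 * (q ^ 4) ^ p.2)))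
    (d := fun p => p.1 - p.2)
    (c' := fun p : ℤ × ℤ × ℤ => qPoch q q *
      (thetaTerm q (q ^ 2) p.1 * (thetaTerm 1 (q ^ 6) p.2.1 * thetaTerm (q ^ 4) (q ^ 6) p.2.2)))
    (d' := fun p => p.1 + p.2.1 + p.2.2)
    (by simpa only [norm_mul] using ((summable_norm_thetaTerm one_ne_zero hq0 hq).mul_norm
      (summable_norm_recipCoeff_mul_zpow hq60 hq6 hq64 hq4)).mul_left _)
    (by simpa only [norm_mul] using ((summable_norm_thetaTerm hq0 hq20 hq2).mul_norm
      ((summable_norm_thetaTerm one_ne_zero hq60 hq6).mul_norm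
        (summable_norm_thetaTerm hq40 hq60 hq6))).mul_left _)
    fun z hz => by
      have hz0 : z ≠ 0 := norm_pos_iff.1 (hz ▸ one_pos)
      have hnorm : ‖q ^ 4 / z‖ = ‖q ^ 4‖ := by rw [norm_div, hz, div_one]
      simp only [mul_assoc (qPoch _ _), tsum_mul_left]
      rw [tsum_laurent_theta_mul_recipSeries hq0 hq hq60 hq6 hz0 (hnorm ▸ hq64) (hnorm ▸ hq4),
        tsum_laurent_theta_mul_theta_mul_theta hq0 one_ne_zero hq40 hq20 hq2 hq60 hq6 hq60 hq6 hz0,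
        one_mul, theta_mul_recipSeries_eq_theta_mul_theta_mul_theta hq0 hq hz]
  rw [tsum_ite_eq_tsum_comp (e := fun s : ℤ => (s, s)) (fun _ _ h => congrArg Prod.fst h)
      (by simp [Prod.ext_iff, sub_eq_zero, eq_comm]),
    tsum_ite_eq_tsum_comp (e := fun p : ℤ × ℤ => (-(p.1 + p.2), p.1, p.2))
      (fun _ _ h => congrArg Prod.snd h)
      (by simp [Prod.ext_iff]; omega), tsum_mul_left, tsum_mul_left] at hconst
  exact hconst.trans (congrArg _
    (tsum_congr fun p => thetaTerm_neg_add_mul_thetaTerm_mul_thetaTerm hq0 p.1 p.2))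

theorem qPoch_mul_heckeSum (hq0 : q ≠ 0) (hq : ‖q‖ < 1) :
    qPoch (q ^ 2) (q ^ 2) * heckeSum 6 6 1 (q ^ 6) (q ^ 4) q = qPoch q q * binaryTheta q := by
  have hhecke := heckeSum_eq_tsum_recipCoeff (a := 6) (c := 1) hq0 hq (by norm_num) one_ne_zero
    (pow_ne_zero 4 hq0)
  rw [pow_one] at hhecke
  refine (congrArg _ (hhecke.trans (tsum_congr fun s => ?_))).trans
    (qPoch_mul_tsum_thetaTerm_mul_recipCoeff hq0 hq)
  rw [← one_mul (q ^ 4), thetaTerm_mul, one_mul]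
  ring

end ConstantTermEvaluation

section LatticeCosets

lemma tsum_eq_sum_tsum_of_bijective {ι α β E : Type*} [Fintype ι] [NormedAddCommGroup E]
    [CompleteSpace E] {f : ι → α → β} (hf : Function.Bijective fun x : ι × α => f x.1 x.2)
    {F : β → E} (hF : Summable F) : ∑' b, F b = ∑ i, ∑' a, F (f i a) := by
  have hsummable := (Equiv.ofBijective _ hf).summable_iff.2 hF
  exact ((Equiv.ofBijective _ hf).tsum_eq F).symm.trans (hsummable.tsum_prod.trans (tsum_fintype _))

lemma triangle_two_mul (a : ℤ) : 2 * a * (2 * a - 1) / 2 = a * (2 * a - 1) := by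
  rw [mul_assoc, Int.mul_ediv_cancel_left _ two_ne_zero]

lemma triangle_two_mul_add_one (a : ℤ) :
    (2 * a + 1) * (2 * a + 1 - 1) / 2 = a * (2 * a + 1) := by
  rw [show (2 * a + 1) * (2 * a + 1 - 1) = 2 * (a * (2 * a + 1)) by ring,
    Int.mul_ediv_cancel_left _ two_ne_zero]

variable {q : ℂ}

lemma thetaTerm_neg_pow_pow (hq0 : q ≠ 0) (a m : ℕ) (n : ℤ) :
    thetaTerm (-q ^ a) (q ^ m) n = q ^ (m * (n * (n - 1) / 2) + a * n) := by
  rw [← mul_neg_one, thetaTerm_mul, thetaTerm_pow_pow hq0, mul_right_comm, ← mul_zpow]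
  simp

lemma thetaTerm_pow_neg_pow (hq0 : q ≠ 0) (a m : ℕ) (n : ℤ) :
    thetaTerm (q ^ a) (-q ^ m) n =
      (-1 : ℂ) ^ (n + n * (n - 1) / 2) * q ^ (m * (n * (n - 1) / 2) + a * n) := by
  rw [thetaTerm, zpow_add₀ hq0, zpow_mul, zpow_mul, zpow_natCast, zpow_natCast,
    neg_eq_neg_one_mul (q ^ m), mul_zpow, zpow_add₀ (by norm_num)]
  ring

lemma hasSum_theta_mul_theta {x y a b : ℂ} (hx : x ≠ 0) (hy : y ≠ 0) (ha0 : a ≠ 0) (hb0 : b ≠ 0)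
    (ha : ‖a‖ < 1) (hb : ‖b‖ < 1) :
    HasSum (fun p : ℤ × ℤ => thetaTerm x a p.1 * thetaTerm y b p.2) (theta x a * theta y b) :=
  (hasSum_theta hx ha0 ha).mul (hasSum_theta hy hb0 hb) (summable_mul_of_summable_norm
    (summable_norm_thetaTerm hx ha0 ha) (summable_norm_thetaTerm hy hb0 hb))

lemma summable_binaryTheta (hq0 : q ≠ 0) (hq : ‖q‖ < 1) : Summable fun p : ℤ × ℤ =>
    q ^ (4 * p.1 ^ 2 + 2 * p.1 * p.2 + 4 * p.2 ^ 2 - 3 * p.1 + p.2) := by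
  have hq6 : ‖q ^ 6‖ < 1 := norm_pow_lt_one hq (by norm_num)
  have hq60 := pow_ne_zero 6 hq0
  have htriple := ((summable_norm_thetaTerm hq0 (pow_ne_zero 2 hq0)
    (norm_pow_lt_one hq two_ne_zero)).mul_norm ((summable_norm_thetaTerm one_ne_zero hq60
      hq6).mul_norm (summable_norm_thetaTerm (pow_ne_zero 4 hq0) hq60 hq6))).of_norm
  exact (htriple.comp_injective (i := fun p : ℤ × ℤ => (-(p.1 + p.2), p.1, p.2))
    fun _ _ h => congrArg Prod.snd h).congr
      fun p => thetaTerm_neg_add_mul_thetaTerm_mul_thetaTerm hq0 p.1 p.2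

/-- The two cosets of the sublattice `{(m, n) | m ≡ n mod 2}` of `ℤ × ℤ`, each parametrized so that
the quadratic form of `binaryTheta` becomes diagonal. -/
def diagonalCoset : Fin 2 → ℤ × ℤ → ℤ × ℤ :=
  ![fun p => (p.1 - p.2, p.1 + p.2), fun p => (p.1 - p.2 + 1, p.1 + p.2)]

lemma bijective_diagonalCoset :
    Function.Bijective fun x : Fin 2 × (ℤ × ℤ) => diagonalCoset x.1 x.2 := by
  constructor
  · rintro ⟨i, a, b⟩ ⟨j, c, d⟩ h
    fin_cases i <;> fin_cases j <;> simp [diagonalCoset] at h ⊢ <;> omega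
  · rintro ⟨m, n⟩
    obtain ⟨k, hk⟩ : ∃ k, n = m + 2 * k ∨ n = m + 2 * k - 1 := ⟨(n - m + 1) / 2, by omega⟩
    rcases hk with rfl | rfl
    · exact ⟨(0, m + k, k), Prod.ext (by simp [diagonalCoset]) (by simp [diagonalCoset]; ring)⟩
    · exact ⟨(1, m + k - 1, k),
        Prod.ext (by simp [diagonalCoset]; ring) (by simp [diagonalCoset]; ring)⟩

theorem binaryTheta_eq_theta_mul_theta_add (hq0 : q ≠ 0) (hq : ‖q‖ < 1) :
    binaryTheta q = theta (-q ^ 8) (q ^ 20) * theta (-q ^ 10) (q ^ 12) +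
      q * (theta (-q ^ 18) (q ^ 20) * theta (-q ^ 4) (q ^ 12)) := by
  have hpow0 (n : ℕ) : q ^ n ≠ 0 := pow_ne_zero n hq0
  have hq12 : ‖q ^ 12‖ < 1 := norm_pow_lt_one hq (by norm_num)
  have hq20 : ‖q ^ 20‖ < 1 := norm_pow_lt_one hq (by norm_num)
  rw [binaryTheta, tsum_eq_sum_tsum_of_bijective bijective_diagonalCoset
    (summable_binaryTheta hq0 hq), Fin.sum_univ_two]
  refine congrArg₂ _ (.trans (tsum_congr fun ⟨u, w⟩ => ?_)
      (hasSum_theta_mul_theta (neg_ne_zero.2 (hpow0 8)) (neg_ne_zero.2 (hpow0 10)) (hpow0 20)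
        (hpow0 12) hq20 hq12).tsum_eq)
    (.trans (tsum_congr fun ⟨u, w⟩ => ?_)
      ((hasSum_theta_mul_theta (neg_ne_zero.2 (hpow0 18)) (neg_ne_zero.2 (hpow0 4)) (hpow0 20)
        (hpow0 12) hq20 hq12).mul_left q).tsum_eq)
  · rw [thetaTerm_neg_pow_pow hq0, thetaTerm_neg_pow_pow hq0, ← zpow_add₀ hq0]
    congr 1
    simp only [diagonalCoset, Matrix.cons_val_zero]
    push_cast
    linarith [two_mul_triangle u, two_mul_triangle w]
  · rw [thetaTerm_neg_pow_pow hq0, thetaTerm_neg_pow_pow hq0, ← zpow_add₀ hq0, ← zpow_one_add₀ hq0]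
    congr 1
    simp only [diagonalCoset, Matrix.cons_val_one, Matrix.cons_val_zero]
    push_cast
    linarith [two_mul_triangle u, two_mul_triangle w]

/-- The summand of `j(-q³; q⁴) j(q³; q¹⁵)`. -/
noncomputable def leftTerm (q : ℂ) (p : ℤ × ℤ) : ℂ :=
  thetaTerm (-q ^ 3) (q ^ 4) p.1 * thetaTerm (q ^ 3) (q ^ 15) p.2

/-- The summand of `j(q⁴; -q¹⁰) j(q¹⁸; q²⁴)`, which accounts for four of the eight cosets of the
lattice of `leftTerm`. -/
noncomputable def evenTerm (q : ℂ) (p : ℤ × ℤ) : ℂ :=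
  thetaTerm (q ^ 4) (-q ^ 10) p.1 * thetaTerm (q ^ 18) (q ^ 24) p.2

/-- The summand of `j(q¹²; q²⁴) j(q⁸; q⁴⁰)`, which accounts for two of the eight cosets of the
lattice of `leftTerm`. -/
noncomputable def oddTerm (q : ℂ) (p : ℤ × ℤ) : ℂ :=
  thetaTerm (q ^ 12) (q ^ 24) p.1 * thetaTerm (q ^ 8) (q ^ 40) p.2

/-- The four classes of `m + 2l mod 4` of the pairs `(m, l)`. -/
def evenCoset : Fin 4 → ℤ × ℤ → ℤ × ℤ :=
  ![fun p => (2 * (p.2 + 2 * p.1), p.2), fun p => (2 * (p.2 + 2 * p.1 + 1) + 1, p.2),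
    fun p => (2 * (p.2 + 2 * p.1 + 1), p.2), fun p => (2 * (p.2 + 2 * p.1) + 1, p.2)]

/-- The two classes of `m + l mod 2` of the pairs `(m, l)`. -/
def oddCoset : Fin 2 → ℤ × ℤ → ℤ × ℤ :=
  ![fun p => (p.2, p.2 + 2 * p.1), fun p => (p.2, p.2 + 2 * p.1 + 1)]

/-- The four cosets on which `leftTerm` matches `evenTerm` on `evenCoset`. -/
def leftEvenCoset : Fin 4 → ℤ × ℤ → ℤ × ℤ :=
  ![fun p => (4 * p.2 + 5 * p.1, 2 * p.1), fun p => (5 * p.1 + p.2 + 3, 2 * (p.2 + p.1 + 1)),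
    fun p => (-5 * p.1 - 4 * p.2 - 3, 2 * p.1 + 1),
    fun p => (-p.2 - 5 * p.1 - 1, 2 * (p.2 + p.1) + 1)]

/-- The two cosets on which `leftTerm` matches `oddTerm` on `oddCoset`. -/
def leftOddCoset : Fin 2 → ℤ × ℤ → ℤ × ℤ :=
  ![fun p => (4 * p.2 + 5 * p.1 - 1, 2 * p.1),
    fun p => (-p.2 - 5 * p.1 - 2, 2 * (p.1 + p.2) + 1)]

/-- The two cosets whose contributions to the sum of `leftTerm` cancel. -/
def leftCancelCoset : Fin 2 → ℤ × ℤ → ℤ × ℤ :=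
  ![fun p => (5 * p.2 - p.1 + 1, 2 * (p.2 - p.1)), fun p => (4 * p.1 - 5 * p.2, 2 * p.2 + 1)]

lemma bijective_evenCoset : Function.Bijective fun x : Fin 4 × (ℤ × ℤ) => evenCoset x.1 x.2 := by
  constructor
  · rintro ⟨i, a, b⟩ ⟨j, c, d⟩ h
    fin_cases i <;> fin_cases j <;> simp [evenCoset] at h ⊢ <;> omega
  · rintro ⟨m, l⟩
    obtain ⟨k, hk⟩ : ∃ k, m = 2 * (l + 2 * k) ∨ m = 2 * (l + 2 * k + 1) + 1 ∨
      m = 2 * (l + 2 * k + 1) ∨ m = 2 * (l + 2 * k) + 1 := ⟨(m - 2 * l) / 4, by omega⟩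
    rcases hk with rfl | rfl | rfl | rfl
    exacts [⟨(0, k, l), rfl⟩, ⟨(1, k, l), rfl⟩, ⟨(2, k, l), rfl⟩, ⟨(3, k, l), rfl⟩]

lemma bijective_oddCoset : Function.Bijective fun x : Fin 2 × (ℤ × ℤ) => oddCoset x.1 x.2 := by
  constructor
  · rintro ⟨i, a, b⟩ ⟨j, c, d⟩ h
    fin_cases i <;> fin_cases j <;> simp [oddCoset] at h ⊢ <;> omega
  · rintro ⟨m, l⟩
    obtain ⟨k, hk⟩ : ∃ k, l = m + 2 * k ∨ l = m + 2 * k + 1 := ⟨(l - m) / 2, by omega⟩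
    rcases hk with rfl | rfl
    exacts [⟨(0, k, m), rfl⟩, ⟨(1, k, m), rfl⟩]

/-- The partition of `ℤ × ℤ` into the eight cosets of `leftTerm`. -/
def leftCoset : Fin 4 ⊕ Fin 2 ⊕ Fin 2 → ℤ × ℤ → ℤ × ℤ :=
  Sum.elim leftEvenCoset (Sum.elim leftOddCoset leftCancelCoset)

lemma injective_leftCoset : Function.Injective
    fun x : (Fin 4 ⊕ Fin 2 ⊕ Fin 2) × (ℤ × ℤ) => leftCoset x.1 x.2 := by
  rintro ⟨i | i | i, a, b⟩ ⟨j | j | j, c, d⟩ h <;> fin_cases i <;> fin_cases j <;>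
    simp [leftCoset, leftEvenCoset, leftOddCoset, leftCancelCoset] at h ⊢ <;> omega

lemma surjective_leftCoset : Function.Surjective
    fun x : (Fin 4 ⊕ Fin 2 ⊕ Fin 2) × (ℤ × ℤ) => leftCoset x.1 x.2 := by
  rintro ⟨k, n⟩
  rcases n.even_or_odd' with ⟨h, rfl | rfl⟩
  · obtain ⟨m, hm⟩ : ∃ m, k = 4 * m + h ∨ k = 4 * m + h + 1 ∨ k = 4 * m + h + 2 ∨
      k = 4 * m + h + 3 := ⟨(k - h) / 4, by omega⟩
    rcases hm with rfl | rfl | rfl | rfl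
    · exact ⟨(.inl 0, h, m - h), Prod.ext (by simp [leftCoset, leftEvenCoset]; ring) rfl⟩
    · exact ⟨(.inr (.inr 0), m - h, m), Prod.ext (by simp [leftCoset, leftCancelCoset]; ring)
        (by simp [leftCoset, leftCancelCoset])⟩
    · exact ⟨(.inl 1, m, h - m - 1), Prod.ext (by simp [leftCoset, leftEvenCoset]; ring)
        (by simp [leftCoset, leftEvenCoset]; ring)⟩
    · exact ⟨(.inr (.inl 0), h, m - h + 1), Prod.ext (by simp [leftCoset, leftOddCoset]; ring) rfl⟩
  · obtain ⟨m, hm⟩ : ∃ m, k = 4 * m - h ∨ k = 4 * m - h - 1 ∨ k = 4 * m - h - 2 ∨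
      k = 4 * m - h - 3 := ⟨(k + h + 3) / 4, by omega⟩
    rcases hm with rfl | rfl | rfl | rfl
    · exact ⟨(.inr (.inr 1), m + h, h), Prod.ext (by simp [leftCoset, leftCancelCoset]; ring) rfl⟩
    · exact ⟨(.inl 3, -m, h + m), Prod.ext (by simp [leftCoset, leftEvenCoset]; ring)
        (by simp [leftCoset, leftEvenCoset])⟩
    · exact ⟨(.inr (.inl 1), -m, h + m), Prod.ext (by simp [leftCoset, leftOddCoset]; ring)
        (by simp [leftCoset, leftOddCoset])⟩
    · exact ⟨(.inl 2, h, -m - h), Prod.ext (by simp [leftCoset, leftEvenCoset]; ring) rfl⟩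

lemma leftTerm_eq (hq0 : q ≠ 0) (k n : ℤ) : leftTerm q (k, n) =
    (-1 : ℂ) ^ n * q ^ (4 * (k * (k - 1) / 2) + 3 * k + (15 * (n * (n - 1) / 2) + 3 * n)) := by
  rw [leftTerm, thetaTerm_neg_pow_pow hq0, thetaTerm_pow_pow hq0, zpow_add₀ hq0 (_ + _)]
  push_cast
  ring

lemma evenTerm_eq (hq0 : q ≠ 0) (m l : ℤ) : evenTerm q (m, l) =
    (-1 : ℂ) ^ (m + m * (m - 1) / 2 + l) *
      q ^ (10 * (m * (m - 1) / 2) + 4 * m + (24 * (l * (l - 1) / 2) + 18 * l)) := by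
  rw [evenTerm, thetaTerm_pow_neg_pow hq0, thetaTerm_pow_pow hq0, zpow_add₀ hq0 (_ + _),
    zpow_add₀ (by norm_num) (_ + _) l]
  push_cast
  ring

lemma mul_oddTerm_eq (hq0 : q ≠ 0) (m l : ℤ) : q * oddTerm q (m, l) =
    (-1 : ℂ) ^ (m + l) *
      q ^ (1 + (24 * (m * (m - 1) / 2) + 12 * m + (40 * (l * (l - 1) / 2) + 8 * l))) := by
  rw [oddTerm, thetaTerm_pow_pow hq0, thetaTerm_pow_pow hq0, zpow_one_add₀ hq0,
    zpow_add₀ hq0 (_ + _), zpow_add₀ (by norm_num : (-1 : ℂ) ≠ 0)]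
  push_cast
  ring

lemma neg_one_zpow_mul_zpow_congr {e e' E E' : ℤ} (he : Even (e - e')) (hE : E = E') :
    (-1 : ℂ) ^ e * q ^ E = (-1 : ℂ) ^ e' * q ^ E' := by
  rw [hE, ← sub_add_cancel e e', zpow_add₀ (by norm_num), he.neg_one_zpow, one_mul]

lemma leftTerm_leftEvenCoset (hq0 : q ≠ 0) (c : Fin 4) (p : ℤ × ℤ) :
    leftTerm q (leftEvenCoset c p) = evenTerm q (evenCoset c p) := by
  obtain ⟨i, l⟩ := p
  fin_cases c
  all_goals
    simp only [leftEvenCoset, evenCoset, Fin.zero_eta, Fin.mk_one, Fin.reduceFinMk,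
      Matrix.cons_val]
    rw [leftTerm_eq hq0, evenTerm_eq hq0]
    simp only [triangle_two_mul, triangle_two_mul_add_one]
  · exact neg_one_zpow_mul_zpow_congr ⟨-((l + 2 * i) ^ 2 + l), by ring⟩
      (by linarith [two_mul_triangle (4 * l + 5 * i), two_mul_triangle l])
  · exact neg_one_zpow_mul_zpow_congr ⟨-((l + 2 * i + 1) ^ 2 + l + 2 * i + 1), by ring⟩
      (by linarith [two_mul_triangle (5 * i + l + 3), two_mul_triangle l])
  · exact neg_one_zpow_mul_zpow_congr ⟨-((l + 2 * i + 1) ^ 2 + l), by ring⟩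
      (by linarith [two_mul_triangle (-5 * i - 4 * l - 3), two_mul_triangle l])
  · exact neg_one_zpow_mul_zpow_congr ⟨-((l + 2 * i) ^ 2 + l + 2 * i), by ring⟩
      (by linarith [two_mul_triangle (-l - 5 * i - 1), two_mul_triangle l])

lemma leftTerm_leftOddCoset (hq0 : q ≠ 0) (c : Fin 2) (p : ℤ × ℤ) :
    leftTerm q (leftOddCoset c p) = q * oddTerm q (oddCoset c p) := by
  obtain ⟨i, n⟩ := p
  fin_cases c
  all_goals
    simp only [leftOddCoset, oddCoset, Fin.zero_eta, Fin.mk_one, Matrix.cons_val]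
    rw [leftTerm_eq hq0, mul_oddTerm_eq hq0]
    simp only [triangle_two_mul, triangle_two_mul_add_one]
  · exact neg_one_zpow_mul_zpow_congr ⟨-n, by ring⟩
      (by linarith [two_mul_triangle (4 * n + 5 * i - 1), two_mul_triangle n,
        two_mul_triangle (n + 2 * i)])
  · exact neg_one_zpow_mul_zpow_congr ⟨0, by ring⟩
      (by linarith [two_mul_triangle (-n - 5 * i - 2), two_mul_triangle n,
        two_mul_triangle (n + 2 * i + 1)])

lemma leftTerm_leftCancelCoset (hq0 : q ≠ 0) (p : ℤ × ℤ) :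
    leftTerm q (leftCancelCoset 0 p) = -leftTerm q (leftCancelCoset 1 p) := by
  obtain ⟨t, a⟩ := p
  have hsign : (-1 : ℂ) ^ (2 * (a - t)) = -(-1 : ℂ) ^ (2 * a + 1) := by
    rw [(even_two_mul _).neg_one_zpow, (odd_two_mul_add_one a).neg_one_zpow, neg_neg]
  simp only [leftCancelCoset, Matrix.cons_val]
  rw [leftTerm_eq hq0, leftTerm_eq hq0, triangle_two_mul, triangle_two_mul_add_one, hsign, neg_mul]
  congr 3
  linarith [two_mul_triangle (5 * a - t + 1), two_mul_triangle (4 * t - 5 * a)]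

theorem theta_mul_theta_eq_add (hq0 : q ≠ 0) (hq : ‖q‖ < 1) :
    theta (-q ^ 3) (q ^ 4) * theta (q ^ 3) (q ^ 15) =
      theta (q ^ 4) (-q ^ 10) * theta (q ^ 18) (q ^ 24) +
        q * (theta (q ^ 12) (q ^ 24) * theta (q ^ 8) (q ^ 40)) := by
  have hpow0 (n : ℕ) : q ^ n ≠ 0 := pow_ne_zero n hq0
  have hpow {n : ℕ} (hn : n ≠ 0) : ‖q ^ n‖ < 1 := norm_pow_lt_one hq hn
  have hleft : HasSum (leftTerm q) _ := hasSum_theta_mul_theta (neg_ne_zero.2 (hpow0 3)) (hpow0 3)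
    (hpow0 4) (hpow0 15) (hpow (by norm_num)) (hpow (by norm_num))
  have heven : HasSum (evenTerm q) _ := hasSum_theta_mul_theta (hpow0 4) (hpow0 18)
    (neg_ne_zero.2 (hpow0 10)) (hpow0 24) (by rw [norm_neg]; exact hpow (by norm_num))
    (hpow (by norm_num))
  have hodd : HasSum (oddTerm q) _ := hasSum_theta_mul_theta (hpow0 12) (hpow0 8)
    (hpow0 24) (hpow0 40) (hpow (by norm_num)) (hpow (by norm_num))
  rw [← hleft.tsum_eq, ← heven.tsum_eq, ← hodd.tsum_eq,
    tsum_eq_sum_tsum_of_bijective ⟨injective_leftCoset, surjective_leftCoset⟩ hleft.summable,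
    tsum_eq_sum_tsum_of_bijective bijective_evenCoset heven.summable,
    tsum_eq_sum_tsum_of_bijective bijective_oddCoset hodd.summable]
  simp only [Fintype.sum_sum_type, leftCoset, Sum.elim_inl, Sum.elim_inr,
    leftTerm_leftEvenCoset hq0, leftTerm_leftOddCoset hq0, tsum_mul_left, mul_sum]
  rw [Fin.sum_univ_two (fun c => ∑' p, leftTerm q (leftCancelCoset c p)),
    tsum_congr (leftTerm_leftCancelCoset hq0), tsum_neg, neg_add_cancel, add_zero]

end LatticeCosets

section ThetaProducts

/-- The product `(q^a; q^m)_∞`. -/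
noncomputable def powPoch (q : ℂ) (a m : ℕ) : ℂ := qPoch (q ^ a) (q ^ m)

/-- The product `(-q^a; q^m)_∞`. -/
noncomputable def negPowPoch (q : ℂ) (a m : ℕ) : ℂ := qPoch (-q ^ a) (q ^ m)

variable {q : ℂ} {a b m d : ℕ}

lemma powPoch_eq_prod_range (hq : ‖q‖ < 1) (a : ℕ) (hm : m ≠ 0) (hd : d ≠ 0) :
    powPoch q a m = ∏ k ∈ range d, powPoch q (a + k * m) (d * m) := by
  rw [powPoch, qPoch_eq_prod_range _ (norm_pow_lt_one hq hm) hd]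
  simp only [powPoch, ← pow_mul, ← pow_add, mul_comm m]

lemma negPowPoch_eq_prod_range (hq : ‖q‖ < 1) (a : ℕ) (hm : m ≠ 0) (hd : d ≠ 0) :
    negPowPoch q a m = ∏ k ∈ range d, negPowPoch q (a + k * m) (d * m) := by
  rw [negPowPoch, qPoch_eq_prod_range _ (norm_pow_lt_one hq hm) hd]
  simp only [negPowPoch, neg_mul, ← pow_mul, ← pow_add, mul_comm m]

lemma powPoch_mul_negPowPoch (hq : ‖q‖ < 1) (a : ℕ) (hm : m ≠ 0) :
    powPoch q a m * negPowPoch q a m = powPoch q (2 * a) (2 * m) := by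
  rw [powPoch, negPowPoch, qPoch_mul_qPoch_neg _ (norm_pow_lt_one hq hm), ← pow_mul, ← pow_mul,
    mul_comm m 2, mul_comm a 2, powPoch]

lemma powPoch_ne_zero (hq : ‖q‖ < 1) (ha : a ≠ 0) (hm : m ≠ 0) : powPoch q a m ≠ 0 :=
  qPoch_ne_zero (norm_pow_lt_one hq ha) (norm_pow_lt_one hq hm)

lemma theta_pow_pow_add (hq0 : q ≠ 0) (hq : ‖q‖ < 1) (hab : a + b ≠ 0) :
    theta (q ^ a) (q ^ (a + b)) =
      powPoch q (a + b) (a + b) * powPoch q a (a + b) * powPoch q b (a + b) := by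
  rw [jacobi_triple_product (pow_ne_zero _ hq0) (pow_ne_zero _ hq0) (norm_pow_lt_one hq hab),
    pow_add, mul_div_cancel_left₀ _ (pow_ne_zero _ hq0), ← pow_add]
  rfl

lemma theta_neg_pow_pow_add (hq0 : q ≠ 0) (hq : ‖q‖ < 1) (hab : a + b ≠ 0) :
    theta (-q ^ a) (q ^ (a + b)) =
      powPoch q (a + b) (a + b) * negPowPoch q a (a + b) * negPowPoch q b (a + b) := by
  rw [jacobi_triple_product (neg_ne_zero.2 (pow_ne_zero _ hq0)) (pow_ne_zero _ hq0)
    (norm_pow_lt_one hq hab), pow_add, div_neg, mul_div_cancel_left₀ _ (pow_ne_zero _ hq0),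
    ← pow_add]
  rfl

lemma theta_sq_neg_pow_five (hq0 : q ≠ 0) (hq : ‖q‖ < 1) :
    theta (q ^ 2) (-q ^ 5) = negPowPoch q 5 10 * powPoch q 10 10 *
      (powPoch q 2 10 * negPowPoch q 7 10) * (negPowPoch q 3 10 * powPoch q 8 10) := by
  have hnq5 : ‖-q ^ 5‖ < 1 := by rw [norm_neg]; exact norm_pow_lt_one hq (by norm_num)
  have split_two (x : ℂ) : qPoch x (-q ^ 5) = qPoch x (q ^ 10) * qPoch (-(x * q ^ 5)) (q ^ 10) := by
    simpa [prod_range_succ, ← pow_mul] using qPoch_eq_prod_range x hnq5 two_ne_zero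
  rw [jacobi_triple_product (pow_ne_zero _ hq0) (neg_ne_zero.2 (pow_ne_zero _ hq0)) hnq5,
    show -q ^ 5 / q ^ 2 = -q ^ 3 by field_simp, split_two, split_two, split_two]
  simp only [powPoch, negPowPoch, neg_mul, neg_neg, ← pow_add]

lemma theta_neg_pow_five_pow_six (hq0 : q ≠ 0) (hq : ‖q‖ < 1) :
    theta (-q ^ 5) (q ^ 6) = theta (q ^ 9) (q ^ 12) * negPowPoch q 1 2 := by
  have hleft : theta (-q ^ 5) (q ^ 6) = powPoch q 6 6 * negPowPoch q 5 6 * negPowPoch q 1 6 :=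
    theta_neg_pow_pow_add hq0 hq (a := 5) (b := 1) (by norm_num)
  have hright : theta (q ^ 9) (q ^ 12) = powPoch q 12 12 * powPoch q 9 12 * powPoch q 3 12 :=
    theta_pow_pow_add hq0 hq (a := 9) (b := 3) (by norm_num)
  have split_six : powPoch q 6 6 = powPoch q 6 12 * powPoch q 12 12 := by
    simpa [prod_range_succ] using powPoch_eq_prod_range hq 6 (m := 6) (by norm_num) two_ne_zero
  have split_three : powPoch q 3 6 = powPoch q 3 12 * powPoch q 9 12 := by
    simpa [prod_range_succ] using powPoch_eq_prod_range hq 3 (m := 6) (by norm_num) two_ne_zero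
  have split_one : negPowPoch q 1 2 = negPowPoch q 1 6 * negPowPoch q 3 6 * negPowPoch q 5 6 := by
    simpa [prod_range_succ] using negPowPoch_eq_prod_range hq 1 two_ne_zero three_ne_zero
  have hmerge : powPoch q 3 6 * negPowPoch q 3 6 = powPoch q 6 12 :=
    powPoch_mul_negPowPoch hq 3 (by norm_num)
  rw [hleft, hright, split_six, split_one, ← hmerge, split_three]
  ring

lemma theta_neg_pow_four_pow_ten_mul (hq0 : q ≠ 0) (hq : ‖q‖ < 1) :
    theta (-q ^ 4) (q ^ 10) * (powPoch q 1 5 * powPoch q 4 5) * negPowPoch q 1 2 =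
      theta (q ^ 2) (-q ^ 5) := by
  have hleft : theta (-q ^ 4) (q ^ 10) = powPoch q 10 10 * negPowPoch q 4 10 * negPowPoch q 6 10 :=
    theta_neg_pow_pow_add hq0 hq (a := 4) (b := 6) (by norm_num)
  have split_five (c : ℕ) : powPoch q c 5 = powPoch q c 10 * powPoch q (c + 5) 10 := by
    simpa [prod_range_succ] using powPoch_eq_prod_range hq c (m := 5) (by norm_num) two_ne_zero
  have split_ten (c : ℕ) : powPoch q c 10 = powPoch q c 20 * powPoch q (c + 10) 20 := by
    simpa [prod_range_succ] using powPoch_eq_prod_range hq c (m := 10) (by norm_num) two_ne_zero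
  have split_neg : negPowPoch q 1 2 = negPowPoch q 1 10 * negPowPoch q 3 10 * negPowPoch q 5 10 *
      negPowPoch q 7 10 * negPowPoch q 9 10 := by
    simpa [prod_range_succ] using
      negPowPoch_eq_prod_range hq 1 two_ne_zero (d := 5) (by norm_num)
  have hmerge (c : ℕ) : powPoch q c 10 * negPowPoch q c 10 = powPoch q (2 * c) 20 :=
    powPoch_mul_negPowPoch hq c (by norm_num)
  calc theta (-q ^ 4) (q ^ 10) * (powPoch q 1 5 * powPoch q 4 5) * negPowPoch q 1 2
    _ = negPowPoch q 5 10 * powPoch q 10 10 * negPowPoch q 7 10 * negPowPoch q 3 10 *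
          ((powPoch q 1 10 * negPowPoch q 1 10) * (powPoch q 6 10 * negPowPoch q 6 10) *
            ((powPoch q 4 10 * negPowPoch q 4 10) * (powPoch q 9 10 * negPowPoch q 9 10))) := by
      rw [hleft, split_five, split_five, split_neg]; ring
    _ = negPowPoch q 5 10 * powPoch q 10 10 * negPowPoch q 7 10 * negPowPoch q 3 10 *
          (powPoch q 2 10 * powPoch q 8 10) := by
      rw [hmerge, hmerge, hmerge, hmerge, split_ten 2, split_ten 8]
    _ = theta (q ^ 2) (-q ^ 5) := by rw [theta_sq_neg_pow_five hq0 hq]; ring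

lemma theta_neg_pow_nine_pow_ten_mul (hq0 : q ≠ 0) (hq : ‖q‖ < 1) :
    theta (-q ^ 9) (q ^ 10) * (powPoch q 1 5 * powPoch q 4 5) =
      theta (q ^ 4) (q ^ 20) * powPoch q 2 4 := by
  have hleft : theta (-q ^ 9) (q ^ 10) = powPoch q 10 10 * negPowPoch q 9 10 * negPowPoch q 1 10 :=
    theta_neg_pow_pow_add hq0 hq (a := 9) (b := 1) (by norm_num)
  have hright : theta (q ^ 4) (q ^ 20) = powPoch q 20 20 * powPoch q 4 20 * powPoch q 16 20 :=
    theta_pow_pow_add hq0 hq (a := 4) (b := 16) (by norm_num)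
  have split_five (c : ℕ) : powPoch q c 5 = powPoch q c 10 * powPoch q (c + 5) 10 := by
    simpa [prod_range_succ] using powPoch_eq_prod_range hq c (m := 5) (by norm_num) two_ne_zero
  have split_ten (c : ℕ) : powPoch q c 10 = powPoch q c 20 * powPoch q (c + 10) 20 := by
    simpa [prod_range_succ] using powPoch_eq_prod_range hq c (m := 10) (by norm_num) two_ne_zero
  have split_two : powPoch q 2 4 = powPoch q 2 20 * powPoch q 6 20 * powPoch q 10 20 *
      powPoch q 14 20 * powPoch q 18 20 := by
    simpa [prod_range_succ] using
      powPoch_eq_prod_range hq 2 (m := 4) (by norm_num) (d := 5) (by norm_num)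
  have hmerge (c : ℕ) : powPoch q c 10 * negPowPoch q c 10 = powPoch q (2 * c) 20 :=
    powPoch_mul_negPowPoch hq c (by norm_num)
  calc theta (-q ^ 9) (q ^ 10) * (powPoch q 1 5 * powPoch q 4 5)
    _ = powPoch q 10 10 * powPoch q 4 10 * powPoch q 6 10 *
          ((powPoch q 1 10 * negPowPoch q 1 10) * (powPoch q 9 10 * negPowPoch q 9 10)) := by
      rw [hleft, split_five, split_five]; ring
    _ = theta (q ^ 4) (q ^ 20) * powPoch q 2 4 := by
      rw [hmerge, hmerge, split_ten 10, split_ten 4, split_ten 6, hright, split_two]; ring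

lemma powPoch_two_four_mul_theta_neg_sq_pow_six (hq0 : q ≠ 0) (hq : ‖q‖ < 1) :
    powPoch q 2 4 * theta (-q ^ 2) (q ^ 6) = theta (q ^ 6) (q ^ 12) := by
  have hleft : theta (-q ^ 2) (q ^ 6) = powPoch q 6 6 * negPowPoch q 2 6 * negPowPoch q 4 6 :=
    theta_neg_pow_pow_add hq0 hq (a := 2) (b := 4) (by norm_num)
  have hright : theta (q ^ 6) (q ^ 12) = powPoch q 12 12 * powPoch q 6 12 * powPoch q 6 12 :=
    theta_pow_pow_add hq0 hq (a := 6) (b := 6) (by norm_num)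
  have split_two : powPoch q 2 2 = powPoch q 2 4 * powPoch q 4 4 := by
    simpa [prod_range_succ] using powPoch_eq_prod_range hq 2 two_ne_zero two_ne_zero
  have split_two' : powPoch q 2 2 = powPoch q 2 6 * powPoch q 4 6 * powPoch q 6 6 := by
    simpa [prod_range_succ] using powPoch_eq_prod_range hq 2 two_ne_zero three_ne_zero
  have split_four : powPoch q 4 4 = powPoch q 4 12 * powPoch q 8 12 * powPoch q 12 12 := by
    simpa [prod_range_succ] using powPoch_eq_prod_range hq 4 four_ne_zero three_ne_zero
  have split_six : powPoch q 6 6 = powPoch q 6 12 * powPoch q 12 12 := by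
    simpa [prod_range_succ] using powPoch_eq_prod_range hq 6 (m := 6) (by norm_num) two_ne_zero
  have hmerge (c : ℕ) : powPoch q c 6 * negPowPoch q c 6 = powPoch q (2 * c) 12 :=
    powPoch_mul_negPowPoch hq c (by norm_num)
  refine mul_left_cancel₀ (powPoch_ne_zero hq four_ne_zero four_ne_zero) ?_
  calc powPoch q 4 4 * (powPoch q 2 4 * theta (-q ^ 2) (q ^ 6))
    _ = powPoch q 6 6 * powPoch q 6 6 *
          ((powPoch q 2 6 * negPowPoch q 2 6) * (powPoch q 4 6 * negPowPoch q 4 6)) := by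
      rw [← mul_assoc, mul_comm (powPoch q 4 4), ← split_two, split_two', hleft]; ring
    _ = powPoch q 4 4 * theta (q ^ 6) (q ^ 12) := by
      rw [hmerge, hmerge, split_six, hright, split_four]; ring

lemma powPoch_one_one_mul_theta_neg_pow_three_pow_four (hq0 : q ≠ 0) (hq : ‖q‖ < 1) :
    powPoch q 1 1 * theta (-q ^ 3) (q ^ 4) = powPoch q 2 2 * powPoch q 2 2 := by
  have hleft : theta (-q ^ 3) (q ^ 4) = powPoch q 4 4 * negPowPoch q 3 4 * negPowPoch q 1 4 :=
    theta_neg_pow_pow_add hq0 hq (a := 3) (b := 1) (by norm_num)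
  have split_one : powPoch q 1 1 = powPoch q 1 2 * powPoch q 2 2 := by
    simpa [prod_range_succ] using powPoch_eq_prod_range hq 1 one_ne_zero two_ne_zero
  have split_neg : negPowPoch q 1 2 = negPowPoch q 1 4 * negPowPoch q 3 4 := by
    simpa [prod_range_succ] using negPowPoch_eq_prod_range hq 1 two_ne_zero two_ne_zero
  have split_two : powPoch q 2 2 = powPoch q 2 4 * powPoch q 4 4 := by
    simpa [prod_range_succ] using powPoch_eq_prod_range hq 2 two_ne_zero two_ne_zero
  have hmerge : powPoch q 1 2 * negPowPoch q 1 2 = powPoch q 2 4 :=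
    powPoch_mul_negPowPoch hq 1 two_ne_zero
  calc powPoch q 1 1 * theta (-q ^ 3) (q ^ 4)
    _ = powPoch q 2 2 * ((powPoch q 1 2 * negPowPoch q 1 2) * powPoch q 4 4) := by
      rw [hleft, split_one, split_neg]; ring
    _ = powPoch q 2 2 * powPoch q 2 2 := by rw [hmerge, ← split_two]

lemma theta_pow_four_pow_ten_mul (hq0 : q ≠ 0) (hq : ‖q‖ < 1) :
    theta (q ^ 4) (q ^ 10) * (powPoch q 2 10 * powPoch q 8 10) = powPoch q 2 2 := by
  have hleft : theta (q ^ 4) (q ^ 10) = powPoch q 10 10 * powPoch q 4 10 * powPoch q 6 10 :=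
    theta_pow_pow_add hq0 hq (a := 4) (b := 6) (by norm_num)
  have split_two : powPoch q 2 2 = powPoch q 2 10 * powPoch q 4 10 * powPoch q 6 10 *
      powPoch q 8 10 * powPoch q 10 10 := by
    simpa [prod_range_succ] using powPoch_eq_prod_range hq 2 two_ne_zero (d := 5) (by norm_num)
  rw [hleft, split_two]
  ring

lemma theta_mul_theta_mul_powPoch_even (hq0 : q ≠ 0) (hq : ‖q‖ < 1) :
    theta (-q ^ 8) (q ^ 20) * theta (-q ^ 10) (q ^ 12) * (powPoch q 2 10 * powPoch q 8 10) =
      theta (q ^ 4) (-q ^ 10) * theta (q ^ 18) (q ^ 24) := by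
  have hfst := theta_neg_pow_five_pow_six (pow_ne_zero 2 hq0) (norm_pow_lt_one hq two_ne_zero)
  have hsnd := theta_neg_pow_four_pow_ten_mul (pow_ne_zero 2 hq0) (norm_pow_lt_one hq two_ne_zero)
  simp only [powPoch, ← pow_mul, Nat.reduceMul] at hfst hsnd ⊢
  linear_combination theta (-q ^ 8) (q ^ 20) * (qPoch (q ^ 2) (q ^ 10) * qPoch (q ^ 8) (q ^ 10)) *
    hfst + theta (q ^ 18) (q ^ 24) * hsnd

lemma theta_mul_theta_mul_powPoch_odd (hq0 : q ≠ 0) (hq : ‖q‖ < 1) :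
    theta (-q ^ 18) (q ^ 20) * theta (-q ^ 4) (q ^ 12) * (powPoch q 2 10 * powPoch q 8 10) =
      theta (q ^ 12) (q ^ 24) * theta (q ^ 8) (q ^ 40) := by
  have hfst := theta_neg_pow_nine_pow_ten_mul (pow_ne_zero 2 hq0) (norm_pow_lt_one hq two_ne_zero)
  have hsnd := powPoch_two_four_mul_theta_neg_sq_pow_six (pow_ne_zero 2 hq0)
    (norm_pow_lt_one hq two_ne_zero)
  simp only [powPoch, ← pow_mul, Nat.reduceMul] at hfst hsnd ⊢
  linear_combination theta (-q ^ 4) (q ^ 12) * hfst + theta (q ^ 8) (q ^ 40) * hsnd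

lemma binaryTheta_mul_powPoch (hq0 : q ≠ 0) (hq : ‖q‖ < 1) :
    binaryTheta q * (powPoch q 2 10 * powPoch q 8 10) =
      theta (-q ^ 3) (q ^ 4) * theta (q ^ 3) (q ^ 15) := by
  rw [theta_mul_theta_eq_add hq0 hq, binaryTheta_eq_theta_mul_theta_add hq0 hq]
  linear_combination theta_mul_theta_mul_powPoch_even hq0 hq +
    q * theta_mul_theta_mul_powPoch_odd hq0 hq

theorem heckeSum_six_six_one_eq (hq0 : q ≠ 0) (hq : ‖q‖ < 1) :
    heckeSum 6 6 1 (q ^ 6) (q ^ 4) q = theta (q ^ 4) (q ^ 10) * theta (q ^ 3) (q ^ 15) := by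
  have hhecke : powPoch q 2 2 * heckeSum 6 6 1 (q ^ 6) (q ^ 4) q = powPoch q 1 1 * binaryTheta q :=
    by simpa [powPoch] using qPoch_mul_heckeSum hq0 hq
  have hpoch {a m : ℕ} (ha : a ≠ 0) (hm : m ≠ 0) : powPoch q a m ≠ 0 := powPoch_ne_zero hq ha hm
  refine mul_left_cancel₀ (mul_ne_zero (hpoch two_ne_zero two_ne_zero)
    (mul_ne_zero (hpoch (a := 2) (m := 10) (by norm_num) (by norm_num))
      (hpoch (a := 8) (m := 10) (by norm_num) (by norm_num)))) ?_
  linear_combination (powPoch q 2 10 * powPoch q 8 10) * hhecke +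
    powPoch q 1 1 * binaryTheta_mul_powPoch hq0 hq +
    theta (q ^ 3) (q ^ 15) * powPoch_one_one_mul_theta_neg_pow_three_pow_four hq0 hq -
    powPoch q 2 2 * theta (q ^ 3) (q ^ 15) * theta_pow_four_pow_ten_mul hq0 hq

lemma multipliable_one_sub_pow_mul (hq : ‖q‖ < 1) {k : ℕ} (hk : k ≠ 0) (P : ℕ → Prop) :
    Multipliable fun n : {n // P n} => 1 - q ^ (k * (n : ℕ)) := by
  have hsummable : Summable fun n : {n // P n} => ‖-q ^ (k * (n : ℕ))‖ :=
    ((summable_geometric_of_lt_one (norm_nonneg _) (norm_pow_lt_one hq hk)).comp_injective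
      (Subtype.val_injective (p := P))).congr fun n => by simp [pow_mul]
  simpa [sub_eq_add_neg] using multipliable_one_add_of_summable hsummable

lemma tprod_one_sub_pow_eq_prod_powPoch {ι : Type*} [Fintype ι] (hq : ‖q‖ < 1) {k m : ℕ}
    (hk : k ≠ 0) (hm : m ≠ 0) {r : ι → ℕ}
    (hr : Function.Injective fun x : ι × ℕ => m * x.2 + r x.1) {P : ℕ → Prop}
    (hP : ∀ n, P n ↔ ∃ c i, m * i + r c = n) :
    ∏' n : {n // P n}, (1 - q ^ (k * (n : ℕ))) = ∏ c, powPoch q (k * r c) (k * m) := by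
  let e : ι × ℕ ≃ {n // P n} :=
    .ofBijective (fun x => ⟨m * x.2 + r x.1, (hP _).2 ⟨x.1, x.2, rfl⟩⟩)
      ⟨fun _ _ h => hr (Subtype.mk.inj h), fun ⟨n, hn⟩ => by
        obtain ⟨c, i, hci⟩ := (hP n).1 hn
        exact ⟨(c, i), Subtype.ext hci⟩⟩
  have hfactor (c : ι) (i : ℕ) :
      1 - q ^ (k * (e (c, i) : ℕ)) = 1 - q ^ (k * r c) * (q ^ (k * m)) ^ i := by
    rw [show (e (c, i) : ℕ) = m * i + r c from rfl, ← pow_mul, ← pow_add]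
    ring_nf
  have hprod := (e.multipliable_iff.2
      (multipliable_one_sub_pow_mul hq hk P)).tprod_prod' fun c => by
    simpa only [Function.comp_apply, hfactor] using
      multipliable_qPoch _ (norm_pow_lt_one hq (mul_ne_zero hk hm))
  exact (e.tprod_eq _).symm.trans <| hprod.trans <| (tprod_fintype _).trans <|
    prod_congr rfl fun c _ => tprod_congr (hfactor c)

lemma theta_pow_mul_pow_mul_eq_tprod (hq0 : q ≠ 0) (hq : ‖q‖ < 1) {k : ℕ} (hk : k ≠ 0)
    (ha : 0 < a) (hb : 0 < b) (hab : a ≠ b) {P : ℕ → Prop}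
    (hP : ∀ n, P n ↔ 1 ≤ n ∧ (n % (a + b) = 0 ∨ n % (a + b) = a ∨ n % (a + b) = b)) :
    theta (q ^ (k * a)) (q ^ (k * (a + b))) = ∏' n : {n // P n}, (1 - q ^ (k * (n : ℕ))) := by
  have hkab : k * a + k * b ≠ 0 := by positivity
  have hmod : a % (a + b) = a ∧ b % (a + b) = b :=
    ⟨Nat.mod_eq_of_lt (by omega), Nat.mod_eq_of_lt (by omega)⟩
  rw [tprod_one_sub_pow_eq_prod_powPoch hq hk (m := a + b) (r := ![a + b, a, b]) (by omega),
    Fin.prod_univ_three, mul_add, theta_pow_pow_add hq0 hq hkab]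
  · simp [mul_add]
  · rintro ⟨c, i⟩ ⟨d, j⟩ h
    have hres := congrArg (· % (a + b)) h
    have hcd : c = d := by
      fin_cases c <;> fin_cases d <;> simp [hmod] at hres ⊢ <;> omega
    subst hcd
    exact Prod.ext rfl (Nat.eq_of_mul_eq_mul_left (by omega) (Nat.add_right_cancel h))
  · intro n
    have hdiv := Nat.div_add_mod n (a + b)
    rw [hP]
    constructor
    · rintro ⟨hn, h | h | h⟩
      · obtain ⟨i, hi⟩ : ∃ i, n / (a + b) = i + 1 :=
          Nat.exists_eq_succ_of_ne_zero fun h0 => by simp [h0, h] at hdiv; omega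
        exact ⟨0, i, by rw [hi, h] at hdiv; simpa [mul_add] using hdiv⟩
      · exact ⟨1, n / (a + b), by simpa [h] using hdiv⟩
      · exact ⟨2, n / (a + b), by simpa [h] using hdiv⟩
    · rintro ⟨c, i, rfl⟩
      fin_cases c <;> simp [hmod] <;> omega

lemma theta_pow_four_pow_ten_eq_tprod (hq0 : q ≠ 0) (hq : ‖q‖ < 1) :
    theta (q ^ 4) (q ^ 10) =
      ∏' n : {n : ℕ // 1 ≤ n ∧ n % 5 ≠ 1 ∧ n % 5 ≠ 4}, (1 - q ^ (2 * (n : ℕ))) :=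
  theta_pow_mul_pow_mul_eq_tprod hq0 hq two_ne_zero (a := 2) (b := 3) (by norm_num) (by norm_num)
    (by norm_num) (by omega)

lemma theta_pow_three_pow_fifteen_eq_tprod (hq0 : q ≠ 0) (hq : ‖q‖ < 1) :
    theta (q ^ 3) (q ^ 15) =
      ∏' n : {n : ℕ // 1 ≤ n ∧ n % 5 ≠ 2 ∧ n % 5 ≠ 3}, (1 - q ^ (3 * (n : ℕ))) :=
  theta_pow_mul_pow_mul_eq_tprod hq0 hq three_ne_zero (a := 1) (b := 4) (by norm_num) (by norm_num)
    (by norm_num) (by omega)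

end ThetaProducts

section StringFunction

/-- The odd integer `(-1)^u (2 u + 1)`. The map `u ↦ signedOdd u` is two-to-one onto the integers
that are `1` modulo `4`, with fibres `{u, -1 - u}`. -/
def signedOdd (u : ℤ) : ℤ := if u % 2 = 0 then 2 * u + 1 else -(2 * u + 1)

lemma signedOdd_sq (u : ℤ) : signedOdd u ^ 2 = (2 * u + 1) ^ 2 := by
  rw [signedOdd]; split_ifs <;> ring

lemma abs_signedOdd (u : ℤ) : |signedOdd u| = |2 * u + 1| :=
  sq_eq_sq_iff_abs_eq_abs _ _ |>.1 (signedOdd_sq u)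

lemma signedOdd_neg_one_sub (u : ℤ) : signedOdd (-1 - u) = signedOdd u := by
  simp only [signedOdd]; split_ifs <;> omega

lemma signedOdd_eq_signedOdd_iff {u v : ℤ} : signedOdd u = signedOdd v ↔ u = v ∨ u = -1 - v := by
  simp only [signedOdd]; split_ifs <;> omega

lemma exists_signedOdd_eq (u : ℤ) : ∃ i, signedOdd u = 4 * i + 1 :=
  ⟨(signedOdd u - 1) / 4, by simp only [signedOdd]; split_ifs <;> omega⟩

lemma exists_nonneg_signedOdd_eq (i : ℤ) : ∃ u, 0 ≤ u ∧ signedOdd u = 4 * i + 1 := by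
  rcases le_or_gt 0 i with hi | hi
  · exact ⟨2 * i, by omega, by simp only [signedOdd]; split_ifs <;> omega⟩
  · exact ⟨-2 * i - 1, by omega, by simp only [signedOdd]; split_ifs <;> omega⟩

lemma sign_signedOdd (u : ℤ) :
    (if 0 ≤ signedOdd u then 1 else -1 : ℂ) = (if 0 ≤ u then 1 else -1) * (-1) ^ u := by
  rcases Int.even_or_odd' u with ⟨k, rfl | rfl⟩
  · rw [(even_two_mul k).neg_one_zpow, mul_one]
    congr 1
    simp only [signedOdd, eq_iff_iff]; omega
  · rw [(odd_two_mul_add_one k).neg_one_zpow]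
    simp only [signedOdd]; split_ifs <;> first | omega | norm_num

/-- The point of the Kac–Peterson index set that belongs to the index pair `(r, s)`. -/
noncomputable def kpPoint (p : ℤ × ℤ) : ℝ × ℝ :=
  ((signedOdd (p.1 + p.2) : ℝ) / 4, ((1 - 10 * p.2 : ℤ) : ℝ) / 20)

lemma mem_cone_iff (m n : ℤ) :
    (-|(m : ℝ) / 4| < (n : ℝ) / 20 ∧ (n : ℝ) / 20 ≤ |(m : ℝ) / 4|) ↔
      (-(5 * |m|) < n ∧ n ≤ 5 * |m|) := by
  rw [abs_div, ← Int.cast_abs, abs_of_pos (by norm_num : (0 : ℝ) < 4),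
    ← Int.cast_lt (R := ℝ), ← Int.cast_le (R := ℝ)]
  push_cast
  constructor <;> rintro ⟨h1, h2⟩ <;> constructor <;> linarith

lemma inCoset_or_inCoset_iff (x y : ℝ) :
    InCoset 1 5 10 x y ∨ InCoset 1 5 10 (1 / 2 - x) (1 / 2 + y) ↔
      ∃ i s : ℤ, x = ((4 * i + 1 : ℤ) : ℝ) / 4 ∧ y = ((1 - 10 * s : ℤ) : ℝ) / 20 := by
  constructor
  · rintro (⟨i, k, hx, hy⟩ | ⟨i, k, hx, hy⟩)
    · refine ⟨i, -2 * k, ?_, ?_⟩ <;> push_cast at hx hy ⊢ <;> linarith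
    · refine ⟨-i, 1 - 2 * k, ?_, ?_⟩ <;> push_cast at hx hy ⊢ <;> linarith
  · rintro ⟨i, s, rfl, rfl⟩
    rcases Int.even_or_odd' s with ⟨j, rfl | rfl⟩
    · exact Or.inl ⟨i, -j, by push_cast; ring, by push_cast; ring⟩
    · exact Or.inr ⟨-i, -j, by push_cast; ring, by push_cast; ring⟩

lemma kpPoint_mem_kpIndex {p : ℤ × ℤ} (hp : p ∈ nonnegPairs ∪ negPairs) :
    kpPoint p ∈ kpIndex 1 5 10 := by
  obtain ⟨r, s⟩ := p
  refine ⟨(mem_cone_iff _ _).2 ?_, (inCoset_or_inCoset_iff _ _).2 ?_⟩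
  · simp only [nonnegPairs, negPairs, Set.mem_union, Set.mem_ofPred_eq] at hp
    rw [abs_signedOdd]
    dsimp only
    rcases abs_cases (2 * (r + s) + 1) with h | h <;> omega
  · obtain ⟨i, hi⟩ := exists_signedOdd_eq (r + s)
    exact ⟨i, s, by rw [kpPoint, hi], rfl⟩

lemma injOn_kpPoint : Set.InjOn kpPoint (nonnegPairs ∪ negPairs) := by
  rintro ⟨r, s⟩ hp ⟨r', s'⟩ hp' h
  simp only [nonnegPairs, negPairs, Set.mem_union, Set.mem_ofPred_eq] at hp hp'
  simp only [kpPoint, Prod.mk.injEq, div_left_inj' (four_ne_zero (α := ℝ)),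
    div_left_inj' (by norm_num : (20 : ℝ) ≠ 0), Int.cast_inj, signedOdd_eq_signedOdd_iff] at h
  rw [Prod.mk.injEq]
  omega

lemma exists_kpPoint_eq {p : ℝ × ℝ} (hp : p ∈ kpIndex 1 5 10) :
    ∃ p' ∈ nonnegPairs ∪ negPairs, kpPoint p' = p := by
  obtain ⟨x, y⟩ := p
  obtain ⟨hcone, hcoset⟩ := hp
  obtain ⟨i, s, rfl, rfl⟩ := (inCoset_or_inCoset_iff _ _).1 hcoset
  obtain ⟨u, hu, hui⟩ := exists_nonneg_signedOdd_eq i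
  rw [← hui, mem_cone_iff, abs_signedOdd, abs_of_nonneg (by omega : 0 ≤ 2 * u + 1)] at hcone
  rcases le_or_gt 0 s with hs | hs
  · refine ⟨(u - s, s), Or.inl ⟨?_, hs⟩, by rw [kpPoint, sub_add_cancel, hui]⟩
    change 0 ≤ u - s
    omega
  · refine ⟨(-1 - u - s, s), Or.inr ⟨?_, hs⟩,
      by rw [kpPoint, sub_add_cancel, signedOdd_neg_one_sub, hui]⟩
    change -1 - u - s < 0
    omega

lemma bijOn_kpPoint : Set.BijOn kpPoint (nonnegPairs ∪ negPairs) (kpIndex 1 5 10) :=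
  ⟨fun _ => kpPoint_mem_kpIndex, injOn_kpPoint, fun _ => exists_kpPoint_eq⟩

variable {q : ℂ} {τ : UpperHalfPlane}

lemma qPow_add_intCast (hq : q = Complex.exp (2 * Real.pi * Complex.I * (τ : ℂ))) (a : ℝ) (n : ℤ) :
    qPow τ (a + n) = qPow τ a * q ^ n := by
  rw [hq, qPow, qPow, ← Complex.exp_int_mul, ← Complex.exp_add]
  push_cast
  ring_nf

lemma heckeTerm_pow_pow_eq_zpow (hq0 : q ≠ 0) (a b c : ℤ) (k l : ℕ) (r s : ℤ) :
    heckeTerm a b c (q ^ k) (q ^ l) q (r, s) = (-1 : ℂ) ^ (r + s) *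
      q ^ (k * r + l * s + (a * (r * (r - 1) / 2) + b * r * s + c * (s * (s - 1) / 2))) := by
  rw [heckeTerm, zpow_add₀ hq0 (k * r + l * s), zpow_add₀ hq0 (k * r), zpow_mul, zpow_mul,
    zpow_natCast, zpow_natCast]
  ring

lemma kpForm_kpPoint (r s : ℤ) :
    12 * (kpPoint (r, s)).1 ^ 2 - 10 * (kpPoint (r, s)).2 ^ 2 = 29 / 40 +
      ((6 * r + 4 * s + (6 * (r * (r - 1) / 2) + 6 * r * s + 1 * (s * (s - 1) / 2)) : ℤ) : ℝ) := by
  have hsq : (signedOdd (r + s) : ℝ) ^ 2 = (2 * (r + s) + 1) ^ 2 := by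
    exact_mod_cast signedOdd_sq (r + s)
  have triangle_cast (n : ℤ) : (2 : ℝ) * ((n * (n - 1) / 2 : ℤ) : ℝ) = n * (n - 1) := by
    exact_mod_cast two_mul_triangle n
  have hr := triangle_cast r
  have hs := triangle_cast s
  simp only [kpPoint, div_pow, hsq]
  push_cast at hr hs ⊢
  linear_combination -3 * hr - hs / 2

lemma kpTerm_kpPoint (hq : q = Complex.exp (2 * Real.pi * Complex.I * (τ : ℂ))) (p : ℤ × ℤ) :
    kpTerm 10 τ (kpPoint p) = (if 0 ≤ p.1 + p.2 then 1 else -1) *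
      (qPow τ (29 / 40) * heckeTerm 6 6 1 (q ^ 6) (q ^ 4) q p) := by
  have hq0 : q ≠ 0 := hq ▸ Complex.exp_ne_zero _
  obtain ⟨r, s⟩ := p
  have hsign : 0 ≤ (kpPoint (r, s)).1 ↔ 0 ≤ signedOdd (r + s) := by
    rw [kpPoint, le_div_iff₀ four_pos, zero_mul, Int.cast_nonneg_iff]
  have hform :
      ((10 : ℤ) + 2 : ℝ) * (kpPoint (r, s)).1 ^ 2 - (10 : ℤ) * (kpPoint (r, s)).2 ^ 2 = _ :=
    (by norm_num : _ = _).trans (kpForm_kpPoint r s)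
  rw [kpTerm, hform, qPow_add_intCast hq, heckeTerm_pow_pow_eq_zpow hq0]
  simp only [hsign, sign_signedOdd]
  push_cast
  ring

lemma heckeSummable_six_six_one (hq0 : q ≠ 0) (hq : ‖q‖ < 1) :
    HeckeSummable 6 6 1 (q ^ 6) (q ^ 4) q :=
  heckeSummable (a := 6) (c := 1) hq0 hq (by norm_num) one_ne_zero (pow_ne_zero 4 hq0)

theorem hasSum_kpTerm (hq : q = Complex.exp (2 * Real.pi * Complex.I * (τ : ℂ))) (hq1 : ‖q‖ < 1) :
    HasSum (fun p : kpIndex 1 5 10 => kpTerm 10 τ p)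
      (qPow τ (29 / 40) * heckeSum 6 6 1 (q ^ 6) (q ^ 4) q) := by
  have hq0 : q ≠ 0 := hq ▸ Complex.exp_ne_zero _
  obtain ⟨hnonneg, hneg⟩ := heckeSummable_six_six_one hq0 hq1
  have hdisjoint : Disjoint nonnegPairs negPairs :=
    Set.disjoint_left.2 fun _ hp hp' => hp.1.not_gt hp'.1
  rw [← bijOn_kpPoint.equiv.hasSum_iff, heckeSum, mul_sub, sub_eq_add_neg]
  refine HasSum.add_disjoint (f := fun p => kpTerm 10 τ (kpPoint p)) hdisjoint
    ((hnonneg.hasSum.mul_left _).congr_fun fun ⟨p, hr, hs⟩ => ?_)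
    ((hneg.hasSum.mul_left _).neg.congr_fun fun ⟨p, hr, hs⟩ => ?_)
  · rw [Function.comp_apply, kpTerm_kpPoint hq, if_pos (add_nonneg hr hs), one_mul]
  · rw [Function.comp_apply, kpTerm_kpPoint hq, if_neg (add_neg hr hs).not_ge, neg_one_mul]

end StringFunction

end HeckeString

theorem mainTheorem10 (τ : UpperHalfPlane) (q : ℂ)
    (hq : q = Complex.exp (2 * Real.pi * Complex.I * (τ : ℂ))) :
    -- the Hecke-type double-sum evaluation
    (HeckeString.HeckeSummable 6 6 1 (q ^ 6) (q ^ 4) q ∧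
      HeckeString.heckeSum 6 6 1 (q ^ 6) (q ^ 4) q =
        HeckeString.thetaJ 4 10 q * HeckeString.thetaJ 3 15 q) ∧
    -- the string function of level 10 with `m = 1`, `ℓ = 5` in terms of the double-sum
    ((Summable fun p : HeckeString.kpIndex 1 5 10 => HeckeString.kpTerm 10 τ p) ∧
      HeckeString.stringFunction 1 5 10 τ =
        ModularForm.eta (τ : ℂ) ^ (-3 : ℤ) * HeckeString.qPow τ (29 / 40) *
          HeckeString.heckeSum 6 6 1 (q ^ 6) (q ^ 4) q) ∧
    -- the product evaluation of that string function
    HeckeString.stringFunction 1 5 10 τ =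
      ModularForm.eta (τ : ℂ) ^ (-3 : ℤ) * HeckeString.qPow τ (29 / 40) *
        (∏' n : {n : ℕ // 1 ≤ n ∧ n % 5 ≠ 1 ∧ n % 5 ≠ 4}, (1 - q ^ (2 * (n : ℕ)))) *
        ∏' n : {n : ℕ // 1 ≤ n ∧ n % 5 ≠ 2 ∧ n % 5 ≠ 3}, (1 - q ^ (3 * (n : ℕ))) := by
  have hq0 : q ≠ 0 := hq ▸ Complex.exp_ne_zero _
  have hq1 : ‖q‖ < 1 := hq ▸ UpperHalfPlane.norm_exp_two_pi_I_lt_one τ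
  have hsum := HeckeString.hasSum_kpTerm hq hq1
  have heval := HeckeString.heckeSum_six_six_one_eq hq0 hq1
  have hstr : HeckeString.stringFunction 1 5 10 τ =
      ModularForm.eta (τ : ℂ) ^ (-3 : ℤ) * HeckeString.qPow τ (29 / 40) *
        HeckeString.heckeSum 6 6 1 (q ^ 6) (q ^ 4) q := by
    rw [HeckeString.stringFunction, hsum.tsum_eq, mul_assoc]
  refine ⟨⟨HeckeString.heckeSummable_six_six_one hq0 hq1, heval⟩, ⟨hsum.summable, hstr⟩, ?_⟩
  rw [hstr, heval, HeckeString.theta_pow_four_pow_ten_eq_tprod hq0 hq1,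
    HeckeString.theta_pow_three_pow_fifteen_eq_tprod hq0 hq1, mul_assoc _ (∏' _, _)]
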